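/- A convex lattice polygon $P$ is a convex polygon in the plane with $n\ge 3$ vertices (genuine corners, no three collinear), all of which lie in $\mathbb Z^2$. To dissect $P$ into triangles is to express $P$ as the union of a finite family of (nondegenerate) triangles whose interiors are pairwise disjoint; a lattice triangle is a triangle with vertices in $\mathbb Z^2$; a dissection of $P$ is diagonal if every vertex of each of its triangles is a vertex of $P$. The colour of a lattice point $(x,y)$ is the pair $(x \bmod 2,\, y\bmod 2)$, so there are four colours. The boundary word of $P$ is the cyclic word (finite string up to cyclic permutation) formed by the colours of the vertices of $P$ in counterclockwise order. A contracting step on a cyclic word $(X_1X_2\dots X_m)$, $m\ge 2$, indices modulo $m$, deletes a letter $X_i$ for which $X_{i-1},X_i,X_{i+1}$ are not all distinct; a cyclic word is contractible if some finite sequence (possibly empty) of contracting steps turns it into a word consisting of a single letter. **Theorem.** For every convex lattice polygon $P$ the following are equivalent: 1. $P$ can be dissected into lattice triangles of area $1$; 2. $P$ can be dissected into lattice triangles of integer area; 3. $P$ can be diagonally dissected into lattice triangles of integer area; 4. the boundary word of $P$ is contractible. Moreover, there is a linear-time algorithm that decides whether or not (1)–(4) hold: there are a program for a random access machine and a constant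 $C$ such that, for every $n\ge 3$ and every convex lattice polygon $P$ with $n$ vertices, given as the list of the coordinates of its vertices in counterclockwise order from an arbitrary starting vertex, the program halts after at most $C\,n$ steps with the answer "yes" if (1)–(4) hold and "no" otherwise. (The machine has registers and an indirectly addressed memory, all holding integers; in one step it can load a constant, copy, add or subtract $1$, read the least significant bit of a register, read or write a memory cell, jump if two registers are equal, or halt with an answer.) -/

import Mathlib

/-! ### Lattice points, parity colours, area -/

/-- A point of the integer lattice, as a point of the real plane. -/
def toPlane (p : ℤ × ℤ) : ℝ × ℝ := ((p.1 : ℝ), (p.2 : ℝ))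

/-- The four parities (even/odd, even/odd) of a lattice point, called colours. -/
abbrev Color : Type := ZMod 2 × ZMod 2

/-- The colour of a lattice point: the parities of its two coordinates. -/
def parityColor (p : ℤ × ℤ) : Color := ((p.1 : ZMod 2), (p.2 : ZMod 2))

/-- The determinant of the `3 × 3` matrix with columns `(1, a)`, `(1, b)`, `(1, c)`: twice the
signed area of the triangle `abc`. It is positive iff `a`, `b`, `c` are in counterclockwise order,
and zero iff they are collinear. -/
def orientDet (a b c : ℤ × ℤ) : ℤ :=
  !![1, 1, 1; a.1, b.1, c.1; a.2, b.2, c.2].det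

/-- A (nondegenerate) lattice triangle, given by its three vertices. -/
structure LatticeTriangle where
  vertex : Fin 3 → ℤ × ℤ
  nondegenerate : orientDet (vertex 0) (vertex 1) (vertex 2) ≠ 0

namespace LatticeTriangle

/-- The closed triangle, as a subset of the plane. -/
def region (T : LatticeTriangle) : Set (ℝ × ℝ) :=
  convexHull ℝ (Set.range fun i => toPlane (T.vertex i))

/-- The (unsigned) area of a lattice triangle. -/
noncomputable def area (T : LatticeTriangle) : ℝ :=
  |(orientDet (T.vertex 0) (T.vertex 1) (T.vertex 2) : ℝ)| / 2

end LatticeTriangle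

/-! ### Convex lattice polygons and their dissections -/

/-- A convex lattice polygon with `n ≥ 3` vertices, given by the list of its vertices in
counterclockwise order from some starting vertex. The vertices are genuine corners: no three of them
are collinear. Points `v 0, …, v (n - 1)` are the corners of a convex polygon in counterclockwise
order exactly when every triple of them, taken in this order, is oriented counterclockwise. -/
structure ConvexLatticePolygon where
  n : ℕ
  three_le : 3 ≤ n
  vertex : Fin n → ℤ × ℤ
  counterclockwise : ∀ i j k : Fin n, i < j → j < k →
    0 < orientDet (vertex i) (vertex j) (vertex k)

namespace ConvexLatticePolygon

variable (P : ConvexLatticePolygon)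

/-- The closed polygon, as a subset of the plane. -/
def region : Set (ℝ × ℝ) :=
  convexHull ℝ (Set.range fun i => toPlane (P.vertex i))

/-- The vertices, in counterclockwise order from the starting vertex. -/
def vertexList : List (ℤ × ℤ) := List.ofFn P.vertex

/-- The boundary word: the cyclic word of the colours of the vertices in counterclockwise order. -/
def boundaryWord : Cycle Color := (P.vertexList.map parityColor : List Color)

/-- The finite family `T` of lattice triangles dissects `P`: `P` is their union, and the interiors
of different triangles of the family do not overlap. -/
structure IsDissection {m : ℕ} (T : Fin m → LatticeTriangle) : Prop where
  union_eq : ⋃ i, (T i).region = P.region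
  disjoint_interior : ∀ i j, i ≠ j → Disjoint (interior (T i).region) (interior (T j).region)

/-- `P` can be dissected into lattice triangles of area `1`. -/
def HasUnitAreaDissection : Prop :=
  ∃ (m : ℕ) (T : Fin m → LatticeTriangle), P.IsDissection T ∧ ∀ i, (T i).area = 1

/-- `P` can be dissected into lattice triangles of integer area. -/
def HasIntegralDissection : Prop :=
  ∃ (m : ℕ) (T : Fin m → LatticeTriangle), P.IsDissection T ∧ ∀ i, ∃ k : ℤ, (T i).area = k

/-- `P` can be diagonally dissected into lattice triangles of integer area, i.e. it has such a
dissection with no new vertices: all vertices of the triangles are vertices of `P`. -/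
def HasIntegralDiagonalDissection : Prop :=
  ∃ (m : ℕ) (T : Fin m → LatticeTriangle), P.IsDissection T ∧
    (∀ i j, (T i).vertex j ∈ Set.range P.vertex) ∧ ∀ i, ∃ k : ℤ, (T i).area = k

end ConvexLatticePolygon

/-! ### Cyclic words and contractibility -/

/-- A contracting step on cyclic words of length at least `2`: a letter `x` is deleted, provided
that the letter before it, `x` itself and the letter after it are not all distinct. The cyclic word
is read starting at `x`, so that it is `x :: l` with `l` nonempty; the letter after `x` is then the
first letter of `l`, and the letter before `x` is the last letter of `l`. -/
inductive ContractingStep {α : Type} : Cycle α → Cycle α → Prop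
  | delete (x : α) (l : List α) (hl : l ≠ [])
      (h : ¬ (l.getLast hl ≠ x ∧ x ≠ l.head hl ∧ l.getLast hl ≠ l.head hl)) :
      ContractingStep ((x :: l : List α) : Cycle α) (l : Cycle α)

/-- A cyclic word is contractible if some sequence of contracting steps turns it into a word
consisting of a single letter. -/
def Contractible {α : Type} (w : Cycle α) : Prop :=
  ∃ x : α, Relation.ReflTransGen ContractingStep w (([x] : List α) : Cycle α)

/-! ### A random access machine with a step count -/

namespace RAM

/-- The instructions of a random access machine. It has registers numbered by `ℕ` (a program names
only finitely many of them) and a memory with cells numbered by `ℤ`; all of them hold integers.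
The only arithmetic is adding or subtracting one and reading the least significant bit. -/
inductive Instr
  /-- Put the constant `c` into register `d`. -/
  | const (d : ℕ) (c : ℤ)
  /-- Copy register `s` to register `d`. -/
  | copy (d s : ℕ)
  /-- Increment register `d`. -/
  | succ (d : ℕ)
  /-- Decrement register `d`. -/
  | pred (d : ℕ)
  /-- Put the least significant bit (`0` or `1`) of register `s` into register `d`. -/
  | parity (d s : ℕ)
  /-- Put the content of the memory cell whose address is in register `a` into register `d`. -/
  | load (d a : ℕ)
  /-- Put the content of register `s` into the memory cell whose address is in register `a`. -/
  | store (a s : ℕ)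
  /-- Jump to the instruction number `target` if registers `a` and `b` have the same content. -/
  | jumpIfEq (a b : ℕ) (target : ℕ)
  /-- Stop, with a yes/no answer. -/
  | halt (answer : Bool)

/-- A program is a finite list of instructions, numbered from `0`. -/
abbrev Program : Type := List Instr

/-- A state of the machine: the number of the next instruction, the registers and the memory. -/
structure State where
  pc : ℕ
  reg : ℕ → ℤ
  mem : ℤ → ℤ

/-- The effect of one instruction on the state (`halt` is treated in `run`). -/
def exec (s : State) : Instr → State
  | .const d c => { s with pc := s.pc + 1, reg := Function.update s.reg d c }
  | .copy d r => { s with pc := s.pc + 1, reg := Function.update s.reg d (s.reg r) }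
  | .succ d => { s with pc := s.pc + 1, reg := Function.update s.reg d (s.reg d + 1) }
  | .pred d => { s with pc := s.pc + 1, reg := Function.update s.reg d (s.reg d - 1) }
  | .parity d r => { s with pc := s.pc + 1, reg := Function.update s.reg d (s.reg r % 2) }
  | .load d a => { s with pc := s.pc + 1, reg := Function.update s.reg d (s.mem (s.reg a)) }
  | .store a r => { s with pc := s.pc + 1, mem := Function.update s.mem (s.reg a) (s.reg r) }
  | .jumpIfEq a b t => { s with pc := if s.reg a = s.reg b then t else s.pc + 1 }
  | .halt _ => s

/-- The answer of the program if, started in state `s`, it halts after at most `t` steps (each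
instruction executed counts as one step), and `none` if it does not. -/
def run (prog : Program) : ℕ → State → Option Bool
  | 0, _ => none
  | t + 1, s =>
    match prog[s.pc]? with
    | none => none
    | some (.halt b) => some b
    | some i => run prog t (exec s i)

/-- The initial state on a list of `n` lattice points `(x₀, y₀), …, (xₙ₋₁, yₙ₋₁)`: register `0`
holds `n`, the memory cells `0, 1, 2, 3, …` hold `x₀, y₀, x₁, y₁, …`, everything else is zero. -/
def initState (L : List (ℤ × ℤ)) : State where
  pc := 0
  reg := fun r => if r = 0 then (L.length : ℤ) else 0
  mem := fun a => if 0 ≤ a then (L.flatMap fun p => [p.1, p.2]).getD a.toNat 0 else 0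

/-- The program decides the property `Q` of convex lattice polygons, given by their lists of
vertices, in time linear in the number of vertices. -/
def DecidesInLinearTime (prog : Program) (Q : ConvexLatticePolygon → Prop) : Prop :=
  ∃ C : ℕ, ∀ P : ConvexLatticePolygon, ∃ b : Bool,
    run prog (C * P.n) (initState P.vertexList) = some b ∧ (b = true ↔ Q P)

end RAM

/-!
A lattice triangle has integer area if and only if its three vertices do not have three different
colours (`even_orientDet_iff`). Read a word of colours as a walk on the complete graph on the four
colours, with stops allowed. Contracting steps are then exactly the deletions of stops and
immediate returns, so that a cyclic word is contractible if and only if the closed walk is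
null-homotopic. This is expressed in a free group: the step from `x` to `y` becomes
`transition x y`, and a cyclic word is contractible if and only if the product of its transitions
is trivial (`contractible_coe_iff`).

A diagonal dissection is obtained from a contraction of the boundary word, since each contracting
step cuts off an ear of integer area (`exists_diagonal_tiling_of_contractible`). A triangle of
integer area at least `2` is cut by a suitable lattice point into smaller triangles of integer area
(`exists_splitting_point`), hence by induction into triangles of area `1`.

Conversely, consider a dissection into triangles of integer area. The walk around each triangle is
trivial, and so is the walk around any three lattice points of a line, since at most two colours
occur among them. As the polygon is simply connected, its boundary walk is trivial as well. The
triangles need not meet along full edges, and the proof proceeds directly: the vertices are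
labelled by elements of the free group in the order of a generic linear function such that labels
differ along each edge by the transition (`exists_isFlatOn`). The edges that arrive at a vertex
from below prescribe the same label, because two of them are joined by a short segment close to the
vertex, which runs through triangles that contain the vertex, and neighbouring triangles agree
(`label_eq`). This is where convexity is used. Multiplying the transitions around the boundary then
gives `1`.

The program computes the reduced form of the walk with a stack
(`isClosedTrivial_iff_length_reducedStack`, `RAM.run_contractProgram`).
-/

/-! ### Closed words and the free group -/

section Words

variable {α : Type}

/-- The element of the free group on all ordered pairs of letters that records a step of a walk from
`x` to `y`. It is trivial for `x = y`, and the step from `y` to `x` is its inverse; there are no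
other relations between the steps of a walk, see `walk_ne_one`. -/
def transition (x y : α) : FreeGroup (α × α) :=
  FreeGroup.of (x, y) * (FreeGroup.of (y, x))⁻¹

@[simp] lemma transition_self (x : α) : transition x x = 1 := by
  simp [transition]

@[simp] lemma transition_inv (x y : α) : (transition x y)⁻¹ = transition y x := by
  simp [transition]

@[simp] lemma transition_mul_swap (x y : α) : transition x y * transition y x = 1 := by
  simp [transition]

lemma transition_mul_transition {x y z : α} (h : ¬ (x ≠ y ∧ y ≠ z ∧ x ≠ z)) :
    transition x y * transition y z = transition x z := by
  by_cases hxy : x = y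
  · simp [hxy]
  by_cases hyz : y = z
  · simp [hyz]
  have hxz : x = z := by tauto
  simp [hxz]

/-- The product of the transitions between consecutive letters of a word. -/
def walk : List α → FreeGroup (α × α)
  | [] => 1
  | [_] => 1
  | x :: y :: l => transition x y * walk (y :: l)

@[simp] lemma walk_singleton (x : α) : walk [x] = 1 := rfl

@[simp] lemma walk_cons_cons (x y : α) (l : List α) :
    walk (x :: y :: l) = transition x y * walk (y :: l) := rfl

lemma walk_append (l : List α) (x : α) (m : List α) :
    walk (l ++ x :: m) = walk (l ++ [x]) * walk (x :: m) := by
  induction l with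
  | nil => simp
  | cons a l ih =>
    cases l with
    | nil => simp
    | cons b l =>
      simp only [List.cons_append, walk_cons_cons] at ih ⊢
      rw [ih, mul_assoc]

lemma walk_concat_concat (l : List α) (x y : α) :
    walk (l ++ [x, y]) = walk (l ++ [x]) * transition x y := by
  rw [walk_append]; simp

lemma walk_reverse (l : List α) : walk l.reverse = (walk l)⁻¹ := by
  induction l with
  | nil => simp [walk]
  | cons a l ih =>
    cases l with
    | nil => simp
    | cons b l =>
      have : (a :: b :: l).reverse = l.reverse ++ [b, a] := by simp
      rw [this, walk_concat_concat, walk_cons_cons, mul_inv_rev, ← ih]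
      simp

/-- A word without repetitions of the form `x x` or `x y x`. -/
def IsReducedWalk : List α → Prop
  | [] => True
  | [_] => True
  | [x, y] => x ≠ y
  | x :: y :: z :: l => x ≠ y ∧ x ≠ z ∧ IsReducedWalk (y :: z :: l)

lemma IsReducedWalk.tail {x : α} {l : List α} (h : IsReducedWalk (x :: l)) : IsReducedWalk l := by
  match l, h with
  | [], _ => trivial
  | [_], _ => trivial
  | _ :: _ :: _, h => exact h.2.2

/-- The letters of the free group whose product is `walk l`. -/
def walkLetters : List α → List ((α × α) × Bool)
  | [] => []
  | [_] => []
  | x :: y :: l => ((x, y), true) :: ((y, x), false) :: walkLetters (y :: l)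

lemma mk_walkLetters (l : List α) : FreeGroup.mk (walkLetters l) = walk l := by
  induction l with
  | nil => rfl
  | cons a l ih =>
    cases l with
    | nil => rfl
    | cons b l =>
      rw [walk_cons_cons, ← ih, transition, walkLetters, FreeGroup.of, FreeGroup.of,
        FreeGroup.inv_mk, FreeGroup.mul_mk, FreeGroup.mul_mk]
      rfl

lemma isReduced_walkLetters {l : List α} (h : IsReducedWalk l) :
    FreeGroup.IsReduced (walkLetters l) := by
  induction l with
  | nil => simp [walkLetters]
  | cons a l ih =>
    match l with
    | [] => simp [walkLetters]
    | [b] =>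
      have h : a ≠ b := h
      simp [walkLetters, FreeGroup.isReduced_cons_cons, h]
    | b :: c :: l =>
      obtain ⟨hab, hac, h⟩ := h
      have := ih h
      simp only [walkLetters, FreeGroup.isReduced_cons_cons] at this ⊢
      refine ⟨by simp [hab], ?_, this⟩
      simp [hac]

/-- A walk without stops and immediate returns is a reduced word of the free group. -/
lemma walk_ne_one {l : List α} (h : IsReducedWalk l) (hl : 2 ≤ l.length) : walk l ≠ 1 := by
  classical
  intro h1
  have h2 := (isReduced_walkLetters h).reduce_eq
  have h3 : FreeGroup.reduce (walkLetters l) = FreeGroup.reduce [] := by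
    apply FreeGroup.reduce.sound
    rw [mk_walkLetters, h1]; rfl
  rw [h2] at h3
  match l, hl with
  | x :: y :: l, _ => simp [walkLetters] at h3

/-- The product of the transitions around a cyclic word is trivial. -/
def IsClosedTrivial : List α → Prop
  | [] => True
  | x :: l => walk (x :: (l ++ [x])) = 1

lemma IsClosedTrivial.rotate_one {x : α} {l : List α} (h : IsClosedTrivial (x :: l)) :
    IsClosedTrivial (l ++ [x]) := by
  cases l with
  | nil => exact h
  | cons y l =>
    simp only [IsClosedTrivial, List.cons_append, walk_cons_cons, List.append_assoc,
      List.nil_append] at h ⊢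
    rw [← List.cons_append, walk_concat_concat, List.cons_append]
    exact mul_eq_one_comm.1 h

lemma IsClosedTrivial.rotate (n : ℕ) : ∀ {l : List α}, IsClosedTrivial l →
    IsClosedTrivial (l.rotate n) := by
  induction n with
  | zero => intro l h; simpa using h
  | succ n ih =>
    intro l h
    cases l with
    | nil => simpa using h
    | cons x l =>
      rw [List.rotate_cons_succ]
      exact ih h.rotate_one

lemma IsClosedTrivial.isRotated {l m : List α} (h : IsClosedTrivial l) (hlm : l ~r m) :
    IsClosedTrivial m := by
  obtain ⟨n, rfl⟩ := hlm
  exact h.rotate n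

lemma Contractible.isClosedTrivial {l : List α} (h : Contractible (l : Cycle α)) :
    IsClosedTrivial l := by
  obtain ⟨x, h⟩ := h
  have key : ∀ w : Cycle α, Relation.ReflTransGen ContractingStep w (([x] : List α) : Cycle α) →
      ∀ l : List α, (l : Cycle α) = w → IsClosedTrivial l := by
    intro w hw
    induction hw using Relation.ReflTransGen.head_induction_on with
    | refl =>
      intro l hl
      have h1 : IsClosedTrivial [x] := by simp [IsClosedTrivial]
      exact h1.isRotated (Cycle.coe_eq_coe.1 hl).symm
    | head hstep _ ih =>
      rintro l rfl
      generalize hw : (l : Cycle α) = w at hstep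
      cases hstep with
      | delete y m hm hd =>
        refine IsClosedTrivial.isRotated ?_ (Cycle.coe_eq_coe.1 hw).symm
        have h2 := ih m rfl
        match m, hm, hd, h2 with
        | a :: t, hm, hd, h2 =>
          obtain ⟨m', e, hme⟩ : ∃ m' e, a :: t = m' ++ [e] :=
            ⟨_, _, (List.dropLast_append_getLast (by simp)).symm⟩
          have he : (a :: t).getLast hm = e := by simp [hme]
          rw [he, List.head_cons] at hd
          have h3 := transition_mul_transition hd
          simp only [IsClosedTrivial, List.cons_append, walk_cons_cons] at h2 ⊢
          rw [← List.cons_append, hme, List.append_assoc, List.singleton_append,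
            walk_concat_concat] at h2 ⊢
          rw [← h3, ← mul_assoc, mul_eq_one_iff_eq_inv] at h2
          rw [h2]
          simp
  exact key _ h l rfl

/-- A non-reduced word has an inner letter that may be deleted. -/
lemma exists_deletable_of_not_isReducedWalk {l : List α} (h : ¬ IsReducedWalk l)
    (hl : 3 ≤ l.length) :
    ∃ A e z b B, l = A ++ e :: z :: b :: B ∧ ¬ (e ≠ z ∧ z ≠ b ∧ e ≠ b) := by
  induction l with
  | nil => simp at hl
  | cons x l ih =>
    match l, hl with
    | y :: z :: l, _ =>
      by_cases hd : ¬ (x ≠ y ∧ y ≠ z ∧ x ≠ z)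
      · exact ⟨[], x, y, z, l, rfl, hd⟩
      obtain ⟨h1, h2, h3⟩ := not_not.1 hd
      have h4 : ¬ IsReducedWalk (y :: z :: l) := fun h4 => h ⟨h1, h3, h4⟩
      cases l with
      | nil => exact absurd h2 h4
      | cons a l =>
        obtain ⟨A, e, z', b, B, h5, h6⟩ := ih h4 (by simp)
        exact ⟨x :: A, e, z', b, B, by rw [h5]; rfl, h6⟩

lemma contractible_of_walk_eq_one (n : ℕ) : ∀ (x : α) (l : List α), l.length = n →
    walk (x :: (l ++ [x])) = 1 → Contractible ((x :: l : List α) : Cycle α) := by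
  induction n with
  | zero =>
    intro x l hl _
    rw [List.length_eq_zero_iff.1 hl]
    exact ⟨x, .refl⟩
  | succ n ih =>
    intro x l hl hw
    have hred : ¬ IsReducedWalk (x :: (l ++ [x])) := fun h => walk_ne_one h (by simp) hw
    obtain ⟨A, e, z, b, B, hd, hdist⟩ :=
      exists_deletable_of_not_isReducedWalk hred (by simp [hl])
    -- The deleted letter is an inner letter of the word, so that it belongs to `l`.
    obtain ⟨A', hA⟩ : ∃ A', A ++ [e] = x :: A' := by
      cases A with
      | nil => simp at hd; exact ⟨[], by simp [hd.1]⟩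
      | cons a A => simp at hd; exact ⟨A ++ [e], by simp [hd.1]⟩
    obtain ⟨B', hB⟩ : ∃ B', b :: B = B' ++ [x] := by
      rcases List.eq_nil_or_concat B with rfl | ⟨B', y, rfl⟩
      · have := congrArg List.getLast? hd
        simp [List.getLast?_cons, List.getLast?_append] at this
        exact ⟨[], by simp [this]⟩
      · have := congrArg List.getLast? hd
        simp [List.getLast?_cons, List.getLast?_append] at this
        exact ⟨b :: B', by simp [this]⟩
    have hl' : l = A' ++ z :: B' := by
      have h1 : A ++ e :: z :: b :: B = (A ++ [e]) ++ z :: (b :: B) := by simp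
      rw [h1, hA, hB] at hd
      have h2 : l ++ [x] = (A' ++ z :: B') ++ [x] := by
        simpa using hd
      exact List.append_cancel_right h2
    have hstep : ContractingStep ((x :: l : List α) : Cycle α)
        ((x :: (A' ++ B') : List α) : Cycle α) := by
      have h1 : ((x :: l : List α) : Cycle α) = ((z :: (B' ++ x :: A') : List α) : Cycle α) := by
        rw [hl', Cycle.coe_eq_coe]
        have : x :: (A' ++ z :: B') = (x :: A') ++ (z :: B') := by simp
        rw [this]
        simpa using (List.isRotated_append (l := x :: A') (l' := z :: B'))
      have h2 : ((x :: (A' ++ B') : List α) : Cycle α) = ((B' ++ x :: A' : List α) : Cycle α) := by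
        rw [Cycle.coe_eq_coe]
        simpa using (List.isRotated_append (l := x :: A') (l' := B'))
      rw [h1, h2]
      refine .delete z (B' ++ x :: A') (by simp) ?_
      have h3 : (B' ++ x :: A').getLast (by simp) = e := by
        have : B' ++ x :: A' = (B' ++ A) ++ [e] := by rw [← hA]; simp
        simp [this]
      have h4 : (B' ++ x :: A').head (by simp) = b := by
        cases B' with
        | nil => simp at hB; simp [hB.1]
        | cons c B' => simp at hB; simp [hB.1]
      rwa [h3, h4]
    have hw' : walk (x :: ((A' ++ B') ++ [x])) = 1 := by
      have h1 : x :: ((A' ++ B') ++ [x]) = A ++ e :: b :: B := by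
        rw [List.append_assoc, ← hB, ← List.cons_append, ← hA]; simp
      rw [hd] at hw
      rw [h1, walk_append, walk_cons_cons, ← transition_mul_transition hdist, ← hw,
        walk_append A e (z :: b :: B), walk_cons_cons, walk_cons_cons, mul_assoc]
    obtain ⟨y, hy⟩ := ih x (A' ++ B') (by simp [hl'] at hl ⊢; omega) hw'
    exact ⟨y, .head hstep hy⟩

/-- Contracting steps are the free reductions of the closed walk given by a cyclic word: the word is
contractible if and only if the walk is trivial in the free group. -/
theorem contractible_coe_iff {l : List α} (hl : l ≠ []) :
    Contractible (l : Cycle α) ↔ IsClosedTrivial l := by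
  refine ⟨Contractible.isClosedTrivial, fun h => ?_⟩
  cases l with
  | nil => exact absurd rfl hl
  | cons x l => exact contractible_of_walk_eq_one _ x l rfl h

end Words

/-! ### Reduction of a walk with a stack -/

section Stack

variable {α : Type} [DecidableEq α]

/-- Add the letter `x` to a reduced walk, read from its end (the top of the stack) to its start, and
reduce. -/
def pushReduce (s : List α) (x : α) : List α :=
  if s[0]? = some x then s else if s[1]? = some x then s.tail else x :: s

lemma isReducedWalk_pushReduce {s : List α} (h : IsReducedWalk s) (x : α) :
    IsReducedWalk (pushReduce s x) := by
  unfold pushReduce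
  split_ifs with h1 h2
  · exact h
  · cases s with
    | nil => exact h
    | cons a s => exact h.tail
  · match s, h, h1, h2 with
    | [], _, _, _ => trivial
    | [a], _, h1, _ => simp at h1; exact Ne.symm h1
    | a :: b :: s, h, h1, h2 =>
      simp at h1 h2
      exact ⟨Ne.symm h1, Ne.symm h2, h⟩

lemma walk_pushReduce (a : α) (s : List α) (x : α) :
    walk (pushReduce (a :: s) x) = transition x a * walk (a :: s) := by
  unfold pushReduce
  split_ifs with h1 h2
  · simp at h1; simp [h1]
  · match s, h2 with
    | b :: s, h2 =>
      simp at h2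
      simp [h2, ← mul_assoc]
  · rfl

lemma getLast?_pushReduce (a : α) (s : List α) (x : α) :
    (pushReduce (a :: s) x).getLast? = (a :: s).getLast? := by
  unfold pushReduce
  split_ifs with h1 h2
  · rfl
  · match s, h2 with
    | b :: s, h2 => simp
  · simp

lemma head?_pushReduce (s : List α) (x : α) : (pushReduce s x).head? = some x := by
  unfold pushReduce
  split_ifs with h1 h2
  · simpa [List.head?_eq_getElem?] using h1
  · simpa [List.head?_eq_getElem?] using h2
  · rfl

/-- The stack after the whole word has been read. -/
def reducedStack (l : List α) : List α := l.foldl pushReduce []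

lemma isReducedWalk_reducedStack (l : List α) : IsReducedWalk (reducedStack l) := by
  induction l using List.reverseRecOn with
  | nil => trivial
  | append_singleton l x ih =>
    rw [reducedStack, List.foldl_concat]
    exact isReducedWalk_pushReduce ih x

lemma reducedStack_spec (x : α) (l : List α) :
    walk (reducedStack (x :: l)) = walk (x :: l).reverse ∧
      (reducedStack (x :: l)).getLast? = some x ∧
      (reducedStack (x :: l)).head? = (x :: l).getLast? := by
  induction l using List.reverseRecOn with
  | nil => simp [reducedStack, pushReduce]
  | append_singleton l y ih =>
    rw [reducedStack, ← List.cons_append, List.foldl_concat, ← reducedStack]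
    obtain ⟨h1, h2, h3⟩ := ih
    refine ⟨?_, ?_, ?_⟩
    · match hs : reducedStack (x :: l), h1, h2, h3 with
      | [], _, h2, _ => simp at h2
      | a :: s, h1, _, h3 =>
        rw [walk_pushReduce, h1, List.reverse_concat]
        match hr : (x :: l).reverse, h3 with
        | [], _ => simp at hr
        | b :: r, h3 =>
          have : b = a := by
            rw [← List.reverse_reverse (x :: l), hr] at h3
            simpa using h3.symm
          rw [this]; rfl
    · match hs : reducedStack (x :: l), h2 with
      | [], h2 => simp at h2
      | a :: s, h2 => rw [getLast?_pushReduce, h2]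
    · rw [head?_pushReduce, List.getLast?_concat]

/-- The closed walk is trivial if and only if the reduced walk from its first to its last letter
has at most one step. -/
lemma isClosedTrivial_iff_length_reducedStack {l : List α} (hl : l ≠ []) :
    IsClosedTrivial l ↔ (reducedStack l).length = 1 ∨ (reducedStack l).length = 2 := by
  match l, hl with
  | x :: l, _ =>
    obtain ⟨h1, h2, h3⟩ := reducedStack_spec x l
    have hred := isReducedWalk_reducedStack (x :: l)
    have key : IsClosedTrivial (x :: l) ↔ walk (pushReduce (reducedStack (x :: l)) x) = 1 := by
      match hs : reducedStack (x :: l), h1, h3 with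
      | [], _, h3 => simp [List.getLast?_cons] at h3
      | a :: s, h1, h3 =>
        rw [walk_pushReduce, h1, IsClosedTrivial, ← inv_eq_one, ← walk_reverse]
        have : (x :: (l ++ [x])).reverse = x :: (x :: l).reverse := by simp
        rw [this]
        match hr : (x :: l).reverse, h3 with
        | [], _ => simp at hr
        | b :: r, h3 =>
          have : b = a := by
            rw [← List.reverse_reverse (x :: l), hr] at h3
            simpa using h3.symm
          rw [this]; rfl
    rw [key]
    match hs : reducedStack (x :: l), h2, hred with
    | [], h2, _ => simp at h2
    | [a], h2, _ => simp at h2; simp [pushReduce, h2]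
    | [a, b], h2, h =>
      have h : a ≠ b := h
      simp at h2
      subst h2
      simp [pushReduce, h]
    | a :: b :: c :: s, _, hred =>
      have h4 := isReducedWalk_pushReduce hred x
      have h5 : 2 ≤ (pushReduce (a :: b :: c :: s) x).length := by
        unfold pushReduce
        split_ifs <;> simp
      simpa using walk_ne_one h4 h5

end Stack

/-! ### The program -/

namespace RAM

/-- The colours as the numbers `1, …, 4`. -/
def colorCode (c : Color) : ℤ := 1 + c.1.val + 2 * c.2.val

lemma colorCode_ne_zero (c : Color) : colorCode c ≠ 0 := by
  revert c; decide

lemma colorCode_inj {c d : Color} : colorCode c = colorCode d ↔ c = d := by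
  revert c d; decide

lemma colorCode_parityColor (p : ℤ × ℤ) :
    colorCode (parityColor p) = 1 + p.1 % 2 + 2 * (p.2 % 2) := by
  rw [colorCode, parityColor, ZMod.val_intCast, ZMod.val_intCast]
  rfl

/-- The stack of `pushReduce` is kept in the memory cells with negative addresses, in the code
`colorCode` and with the top at the address in register `3`; the cells `-1` and `-2` below its
bottom hold `0`, which is not a code. Register `0` counts the vertices still to be read, register `1`
is the address of the next one, register `2` holds `0`. The answer is "yes" if the stack has `1` or
`2` elements in the end. -/
def contractProgram : Program :=
  [.const 3 (-2),
   .jumpIfEq 0 2 22,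
   .load 4 1,
   .succ 1,
   .parity 4 4,
   .load 5 1,
   .succ 1,
   .parity 5 5,
   .succ 4,
   .jumpIfEq 5 2 12,
   .succ 4,
   .succ 4,
   .pred 0,
   .load 6 3,
   .jumpIfEq 4 6 1,
   .succ 3,
   .load 6 3,
   .jumpIfEq 4 6 1,
   .pred 3,
   .pred 3,
   .store 3 4,
   .jumpIfEq 2 2 1,
   .const 6 (-3),
   .jumpIfEq 3 6 27,
   .pred 6,
   .jumpIfEq 3 6 27,
   .halt false,
   .halt true]

lemma run_mono {prog : Program} {b : Bool} {t : ℕ} : ∀ {s : State} {t' : ℕ}, t ≤ t' →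
    run prog t s = some b → run prog t' s = some b := by
  induction t with
  | zero => intro s t' _ h; simp [run] at h
  | succ t ih =>
    intro s t' ht h
    obtain ⟨t', rfl⟩ : ∃ k, t' = k + 1 := ⟨t' - 1, by omega⟩
    simp only [run] at h ⊢
    split at h
    · simp at h
    · exact h
    · exact ih (by omega) h

/-- The state at the head of the loop on the input `L`, with the vertices in `l` still to be read
and the stack `st`. -/
structure LoopState (L : List (ℤ × ℤ)) (l : List (ℤ × ℤ)) (st : List Color) (s : State) :
    Prop where
  pc : s.pc = 1
  reg0 : s.reg 0 = l.length
  reg1 : s.reg 1 = 2 * ((L.length : ℤ) - l.length)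
  reg2 : s.reg 2 = 0
  reg3 : s.reg 3 = -2 - st.length
  input : ∀ a : ℤ, 0 ≤ a → s.mem a = (initState L).mem a
  suffix : l <:+ L
  stack : ∀ i : ℕ, i < st.length + 2 → s.mem (-2 - st.length + i) =
    (st[i]?.map colorCode).getD 0

lemma initState_mem (A B : List (ℤ × ℤ)) (p : ℤ × ℤ) :
    (initState (A ++ p :: B)).mem (2 * A.length) = p.1 ∧
      (initState (A ++ p :: B)).mem (2 * A.length + 1) = p.2 := by
  have h : (A.flatMap fun p => [p.1, p.2]).length = 2 * A.length := by
    induction A with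
    | nil => rfl
    | cons a A ih => simp [ih]; ring
  constructor
  · have : (2 * (A.length : ℤ)).toNat = 2 * A.length := by omega
    simp only [initState]
    rw [if_pos (by positivity), this, List.flatMap_append,
      List.getD_append_right _ _ _ _ (by omega), h]
    simp
  · have : (2 * (A.length : ℤ) + 1).toNat = 2 * A.length + 1 := by omega
    simp only [initState]
    rw [if_pos (by positivity), this, List.flatMap_append,
      List.getD_append_right _ _ _ _ (by omega), h]
    simp

/-- Started in `s`, the program comes to a state with the property `Q` in at most `K` steps. -/
def ReachesWithin (prog : Program) (K : ℕ) (s : State) (Q : State → Prop) : Prop :=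
  ∃ k ≤ K, ∃ s', Q s' ∧ ∀ t, run prog (t + k) s = run prog t s'

lemma ReachesWithin.of_state {prog : Program} {K : ℕ} {s : State} {Q : State → Prop} (h : Q s) :
    ReachesWithin prog K s Q := ⟨0, by simp, s, h, fun _ => rfl⟩

lemma ReachesWithin.of_exec {prog : Program} {K : ℕ} {s : State} {Q : State → Prop} (i : Instr)
    (hi : prog[s.pc]? = some i) (hhalt : ∀ b, i ≠ .halt b)
    (h : ReachesWithin prog K (exec s i) Q) : ReachesWithin prog (K + 1) s Q := by
  obtain ⟨k, hk, s', hs', h⟩ := h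
  refine ⟨k + 1, by omega, s', hs', fun t => ?_⟩
  rw [← h, ← add_assoc]
  cases i <;> simp_all [run]

lemma ReachesWithin.trans {prog : Program} {K K' : ℕ} {s : State} {Q Q' : State → Prop}
    (h : ReachesWithin prog K s Q) (h' : ∀ s', Q s' → ReachesWithin prog K' s' Q') :
    ReachesWithin prog (K + K') s Q' := by
  obtain ⟨k, hk, s', hs', h⟩ := h
  obtain ⟨k', hk', s'', hs'', h'⟩ := h' s' hs'
  refine ⟨k' + k, by omega, s'', hs'', fun t => ?_⟩
  rw [← add_assoc, h, h']

/-- Reading a vertex puts the code of its colour into register `4`. -/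
lemma reachesWithin_read (r : ℕ → ℤ) (m : ℤ → ℤ) (h0 : r 0 ≠ 0) (h2 : r 2 = 0) (x y : ℤ)
    (hx : m (r 1) = x) (hy : m (r 1 + 1) = y) :
    ReachesWithin contractProgram 12 ⟨1, r, m⟩ (fun s => s.pc = 13 ∧ s.mem = m ∧
      s.reg 0 = r 0 - 1 ∧ s.reg 1 = r 1 + 2 ∧ s.reg 2 = 0 ∧ s.reg 3 = r 3 ∧
      s.reg 4 = colorCode (parityColor (x, y))) := by
  rw [colorCode_parityColor]
  have h0' : r 0 ≠ r 2 := by rw [h2]; exact h0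
  refine .of_exec (.jumpIfEq 0 2 22) rfl (by simp) ?_
  simp only [exec, if_neg h0']
  refine .of_exec (.load 4 1) rfl (by simp) ?_
  refine .of_exec (.succ 1) rfl (by simp) ?_
  refine .of_exec (.parity 4 4) rfl (by simp) ?_
  refine .of_exec (.load 5 1) rfl (by simp) ?_
  refine .of_exec (.succ 1) rfl (by simp) ?_
  refine .of_exec (.parity 5 5) rfl (by simp) ?_
  refine .of_exec (.succ 4) rfl (by simp) ?_
  simp only [exec]
  rcases Int.emod_two_eq_zero_or_one y with hy2 | hy2
  · refine .of_exec (.jumpIfEq 5 2 12) rfl (by simp) ?_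
    simp only [exec]
    rw [if_pos (by simp [Function.update, hy, hy2, h2])]
    refine .of_exec (.pred 0) rfl (by simp) ?_
    refine .of_state ?_
    simp [exec, Function.update, hx, hy2, h2]
    constructor <;> ring
  · refine .of_exec (.jumpIfEq 5 2 12) rfl (by simp) ?_
    simp only [exec]
    rw [if_neg (by simp [Function.update, hy, hy2, h2])]
    refine .of_exec (.succ 4) rfl (by simp) ?_
    refine .of_exec (.succ 4) rfl (by simp) ?_
    refine .of_exec (.pred 0) rfl (by simp) ?_
    refine .of_state ?_
    simp [exec, Function.update, hx, hy2, h2]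
    constructor <;> ring

/-- The second half of the loop carries out `pushReduce` on the stack. -/
lemma reachesWithin_pushReduce (r : ℕ → ℤ) (m : ℤ → ℤ) (st : List Color) (c : Color)
    (h2 : r 2 = 0) (h3 : r 3 = -2 - st.length) (h4 : r 4 = colorCode c)
    (hst : ∀ i : ℕ, i < st.length + 2 → m (-2 - st.length + i) = (st[i]?.map colorCode).getD 0) :
    ReachesWithin contractProgram 9 ⟨13, r, m⟩ (fun s => s.pc = 1 ∧
      (∀ a : ℤ, 0 ≤ a → s.mem a = m a) ∧
      s.reg 0 = r 0 ∧ s.reg 1 = r 1 ∧ s.reg 2 = 0 ∧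
      s.reg 3 = -2 - (pushReduce st c).length ∧
      ∀ i : ℕ, i < (pushReduce st c).length + 2 → s.mem (-2 - (pushReduce st c).length + i) =
        ((pushReduce st c)[i]?.map colorCode).getD 0) := by
  have eq_iff : ∀ o : Option Color, colorCode c = (o.map colorCode).getD 0 ↔ o = some c := by
    intro o
    cases o with
    | none => simp [colorCode_ne_zero]
    | some d => simp [colorCode_inj, eq_comm]
  have htop : r 4 = m (r 3) ↔ st[0]? = some c := by
    rw [h4, h3, ← eq_iff]
    have := hst 0 (by omega)
    rw [Nat.cast_zero, add_zero] at this
    rw [this]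
  have hnext : r 4 = m (r 3 + 1) ↔ st[1]? = some c := by
    rw [h4, h3, ← eq_iff]
    have := hst 1 (by omega)
    rw [Nat.cast_one] at this
    rw [this]
  refine .of_exec (.load 6 3) rfl (by simp) ?_
  refine .of_exec (.jumpIfEq 4 6 1) rfl (by simp) ?_
  simp only [exec, Function.update_self, ne_eq, Nat.reduceEqDiff,
    not_false_eq_true, Function.update_of_ne]
  by_cases ht : st[0]? = some c
  · rw [if_pos (htop.2 ht)]
    have hp : pushReduce st c = st := by rw [pushReduce, if_pos ht]
    rw [hp]
    exact .of_state ⟨rfl, fun _ _ => rfl, by simp, by simp, by simp [h2], by simp [h3], hst⟩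
  rw [if_neg (fun h => ht (htop.1 h))]
  refine .of_exec (.succ 3) rfl (by simp) ?_
  refine .of_exec (.load 6 3) rfl (by simp) ?_
  refine .of_exec (.jumpIfEq 4 6 1) rfl (by simp) ?_
  simp only [exec, Function.update_self, ne_eq, Nat.reduceEqDiff,
    not_false_eq_true, Function.update_of_ne]
  by_cases hn : st[1]? = some c
  · rw [if_pos (hnext.2 hn)]
    have hp : pushReduce st c = st.tail := by rw [pushReduce, if_neg ht, if_pos hn]
    rw [hp]
    match st, hn with
    | a :: st, _ =>
      refine .of_state ⟨rfl, fun _ _ => rfl, by simp, by simp, by simp [h2], ?_, ?_⟩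
      · simp [h3]; ring
      · intro i hi
        have := hst (i + 1) (by simp at hi ⊢; omega)
        simp only [List.length_cons, List.getElem?_cons_succ, List.tail_cons] at this ⊢
        rw [← this]
        congr 1
        push_cast
        ring
  rw [if_neg (fun h => hn (hnext.1 h))]
  have hp : pushReduce st c = c :: st := by rw [pushReduce, if_neg ht, if_neg hn]
  refine .of_exec (.pred 3) rfl (by simp) ?_
  refine .of_exec (.pred 3) rfl (by simp) ?_
  refine .of_exec (.store 3 4) rfl (by simp) ?_
  refine .of_exec (.jumpIfEq 2 2 1) rfl (by simp) ?_
  rw [hp]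
  refine .of_state ⟨by simp [exec], ?_, by simp [exec], by simp [exec], by simp [exec, h2], ?_, ?_⟩
  · intro a ha
    simp only [exec, Function.update_self, ne_eq, Nat.reduceEqDiff,
      not_false_eq_true, Function.update_of_ne]
    rw [Function.update_of_ne (by rw [h3]; omega)]
  · simp [exec, h3]; ring
  · intro i hi
    simp only [exec, Function.update_self, ne_eq, Nat.reduceEqDiff,
      not_false_eq_true, Function.update_of_ne]
    cases i with
    | zero =>
      have h5 : (-2 : ℤ) - (c :: st).length + (0 : ℕ) = r 3 + 1 - 1 - 1 := by
        rw [h3]; simp; ring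
      rw [h5]
      simp [h4]
    | succ i =>
      rw [Function.update_of_ne (by rw [h3]; simp; omega)]
      have := hst i (by simp at hi; omega)
      rw [List.getElem?_cons_succ, ← this]
      congr 1
      push_cast [List.length_cons]
      ring

lemma LoopState.next {L : List (ℤ × ℤ)} {p : ℤ × ℤ} {l : List (ℤ × ℤ)} {st : List Color}
    {s : State} (h : LoopState L (p :: l) st s) :
    ReachesWithin contractProgram 21 s (LoopState L l (pushReduce st (parityColor p))) := by
  obtain ⟨A, hA⟩ := h.suffix
  have hlen : (L.length : ℤ) - (p :: l).length = A.length := by rw [← hA]; simp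
  have h1 := h.reg1
  rw [hlen] at h1
  have hm := initState_mem A l p
  rw [hA, ← h.input _ (by positivity), ← h.input _ (by positivity), ← h1] at hm
  obtain ⟨pc, r, m⟩ := s
  obtain rfl : pc = 1 := h.pc
  have h0 : r 0 = l.length + 1 := by simpa using h.reg0
  refine .trans (K := 12) (K' := 9) (reachesWithin_read r m (by omega) h.reg2 p.1 p.2 hm.1 hm.2) ?_
  rintro ⟨pc, r', m'⟩ ⟨hpc, hmem, hr0, hr1, hr2, hr3, hr4⟩
  simp only at hpc hmem hr0 hr1 hr2 hr3 hr4
  subst hpc hmem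
  refine .trans (K := 9) (K' := 0) (reachesWithin_pushReduce r' m' st (parityColor p) hr2
    (hr3.trans h.reg3) hr4 h.stack) ?_
  rintro s' ⟨k1, k2, k3, k4, k5, k6, k7⟩
  refine .of_state ⟨k1, ?_, ?_, k5, k6, ?_, ?_, k7⟩
  · rw [k3, hr0, h0]; ring
  · have h1' : r 1 = 2 * A.length := h1
    rw [k4, hr1, h1', ← hA]; simp; ring
  · intro a ha
    rw [k2 a ha]
    exact h.input a ha
  · exact (List.suffix_cons p l).trans h.suffix

lemma LoopState.finish {L : List (ℤ × ℤ)} (l : List (ℤ × ℤ)) :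
    ∀ {st : List Color} {s : State}, LoopState L l st s →
    ReachesWithin contractProgram (21 * l.length) s
      (LoopState L [] ((l.map parityColor).foldl pushReduce st)) := by
  induction l with
  | nil => exact fun h => .of_state h
  | cons p l ih =>
    intro st s h
    have := h.next.trans (fun s' hs' => ih hs')
    rwa [List.length_cons, mul_add, mul_one, add_comm]

lemma run_finish {L : List (ℤ × ℤ)} {st : List Color} {s : State} (h : LoopState L [] st s)
    (t : ℕ) : run contractProgram (t + 6) s = some (decide (st.length = 1 ∨ st.length = 2)) := by
  obtain ⟨pc, r, m⟩ := s
  obtain rfl : pc = 1 := h.pc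
  have h0 : r 0 = 0 := h.reg0
  have h2 : r 2 = 0 := h.reg2
  have h3 : r 3 = -2 - st.length := h.reg3
  by_cases h4 : st.length = 1
  · simp [run, exec, contractProgram, h0, h2, h3, h4]
  by_cases h5 : st.length = 2
  · simp [run, exec, contractProgram, h0, h2, h3, h5]
  have h6 : ¬ ((-2 : ℤ) - st.length = -3) := by omega
  have h7 : ¬ ((-2 : ℤ) - st.length = -4) := by omega
  simp [run, exec, contractProgram, h0, h2, h3, h4, h5, h6, h7]

/-- The program decides in linear time whether or not the cyclic word of the colours of a list of
lattice points is contractible. -/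
theorem run_contractProgram {L : List (ℤ × ℤ)} (hL : L ≠ []) {t : ℕ}
    (ht : 21 * L.length + 7 ≤ t) : ∃ b : Bool, run contractProgram t (initState L) = some b ∧
      (b = true ↔ Contractible ((L.map parityColor : List Color) : Cycle Color)) := by
  have hstart : ReachesWithin contractProgram 1 (initState L) (LoopState L L []) := by
    refine .of_exec (.const 3 (-2)) rfl (by simp) (.of_state ?_)
    refine ⟨rfl, by simp [exec, initState], by simp [exec, initState], by simp [exec, initState],
      by simp [exec], fun _ _ => rfl, List.suffix_rfl, ?_⟩
    intro i hi
    simp only [exec, initState]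
    rw [if_neg (by simp at hi ⊢; omega)]
    simp
  obtain ⟨k, hk, s', hs', hrun⟩ := hstart.trans (fun s hs => LoopState.finish L hs)
  have h1 := run_finish hs' 0
  rw [← hrun] at h1
  refine ⟨_, run_mono (by omega) h1, ?_⟩
  rw [contractible_coe_iff (by simpa using hL),
    isClosedTrivial_iff_length_reducedStack (by simpa using hL)]
  simp [reducedStack]

end RAM

/-! ### Orientation determinants and triangles -/

/-- Twice the signed area of the triangle `abc` in the real plane. -/
def det3 (a b c : ℝ × ℝ) : ℝ := (b.1 - a.1) * (c.2 - a.2) - (b.2 - a.2) * (c.1 - a.1)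

lemma orientDet_eq (a b c : ℤ × ℤ) :
    orientDet a b c = (b.1 - a.1) * (c.2 - a.2) - (b.2 - a.2) * (c.1 - a.1) := by
  simp [orientDet, Matrix.det_fin_three]
  ring

lemma cast_orientDet (a b c : ℤ × ℤ) :
    (orientDet a b c : ℝ) = det3 (toPlane a) (toPlane b) (toPlane c) := by
  simp [orientDet_eq, det3, toPlane]

lemma orientDet_rotate (a b c : ℤ × ℤ) : orientDet b c a = orientDet a b c := by
  simp only [orientDet_eq]; ring

lemma toPlane_injective : Function.Injective toPlane := by
  rintro ⟨a, b⟩ ⟨c, d⟩ h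
  simpa [toPlane] using h

lemma det3_rotate (a b c : ℝ × ℝ) : det3 b c a = det3 a b c := by
  simp only [det3]; ring

lemma det3_swap (a b c : ℝ × ℝ) : det3 b a c = - det3 a b c := by
  simp only [det3]; ring

@[simp] lemma det3_self_left (a b : ℝ × ℝ) : det3 a b a = 0 := by
  simp only [det3]; ring

@[simp] lemma det3_self_right (a b : ℝ × ℝ) : det3 a b b = 0 := by
  simp only [det3]; ring

lemma det3_combination (a b x y : ℝ × ℝ) {s t : ℝ} (h : s + t = 1) :
    det3 a b (s • x + t • y) = s * det3 a b x + t * det3 a b y := by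
  obtain rfl : s = 1 - t := by linarith
  simp only [det3, Prod.fst_add, Prod.snd_add, Prod.smul_fst, Prod.smul_snd, smul_eq_mul]
  ring

lemma convex_det3_nonneg (a b : ℝ × ℝ) : Convex ℝ {x | 0 ≤ det3 a b x} := by
  intro x hx y hy s t hs ht hst
  replace hx : 0 ≤ det3 a b x := hx
  replace hy : 0 ≤ det3 a b y := hy
  change 0 ≤ det3 a b (s • x + t • y)
  rw [det3_combination a b x y hst]
  positivity

lemma convex_det3_nonpos (a b : ℝ × ℝ) : Convex ℝ {x | det3 a b x ≤ 0} := by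
  have := convex_det3_nonneg b a
  simpa only [det3_swap a b, Left.nonneg_neg_iff] using this

lemma continuous_det3 (a b : ℝ × ℝ) : Continuous (det3 a b) := by
  unfold det3; fun_prop

/-- Every point of the plane is the combination of the vertices of a triangle with the areas of the
opposite triangles as weights. -/
lemma det3_smul_eq (a b c x : ℝ × ℝ) :
    det3 a b c • x = det3 b c x • a + det3 c a x • b + det3 a b x • c := by
  ext <;> simp only [det3, Prod.fst_add, Prod.snd_add, Prod.smul_fst, Prod.smul_snd,
    smul_eq_mul] <;> ring

lemma det3_add_det3_add_det3 (a b c x : ℝ × ℝ) :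
    det3 b c x + det3 c a x + det3 a b x = det3 a b c := by
  simp only [det3]; ring

lemma mem_convexHull_triple {a b c : ℝ × ℝ} (h : 0 < det3 a b c) (x : ℝ × ℝ) :
    x ∈ convexHull ℝ {a, b, c} ↔ 0 ≤ det3 a b x ∧ 0 ≤ det3 b c x ∧ 0 ≤ det3 c a x := by
  constructor
  · intro hx
    have key : ∀ p q : ℝ × ℝ, 0 ≤ det3 p q a → 0 ≤ det3 p q b → 0 ≤ det3 p q c →
        0 ≤ det3 p q x := fun p q ha hb hc => by
      refine convexHull_min ?_ (convex_det3_nonneg p q) hx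
      rintro y (rfl | rfl | rfl) <;> assumption
    refine ⟨key a b ?_ ?_ ?_, key b c ?_ ?_ ?_, key c a ?_ ?_ ?_⟩ <;>
      first | simp | exact h.le | (rw [det3_rotate]; exact h.le) |
        (rw [← det3_rotate]; exact h.le)
  · rintro ⟨hc, ha, hb⟩
    have h1 := det3_smul_eq a b c x
    have h2 := det3_add_det3_add_det3 a b c x
    set D := det3 a b c
    have h3 : x = (det3 b c x / D) • a + (det3 c a x / D) • b + (det3 a b x / D) • c := by
      have := congrArg (fun y => D⁻¹ • y) h1
      simp only [smul_add, smul_smul, inv_mul_cancel₀ h.ne', one_smul] at this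
      simp only [div_eq_inv_mul]
      exact this
    rw [h3]
    have := (convex_convexHull ℝ {a, b, c}).sum_mem (t := Finset.univ)
      (w := ![det3 b c x / D, det3 c a x / D, det3 a b x / D]) (z := ![a, b, c])
      (by intro i _; fin_cases i <;> simp <;> positivity)
      (by
        simp only [Fin.sum_univ_three, Matrix.cons_val]
        rw [← add_div, ← add_div, h2, div_self h.ne'])
      (by intro i _; apply subset_convexHull; fin_cases i <;> simp)
    simpa [Fin.sum_univ_three] using this

/-- The closed triangle with the given lattice points as vertices. -/
def tri (a b c : ℤ × ℤ) : Set (ℝ × ℝ) := convexHull ℝ {toPlane a, toPlane b, toPlane c}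

lemma mem_tri {a b c : ℤ × ℤ} (h : 0 < orientDet a b c) (x : ℝ × ℝ) :
    x ∈ tri a b c ↔ 0 ≤ det3 (toPlane a) (toPlane b) x ∧ 0 ≤ det3 (toPlane b) (toPlane c) x ∧
      0 ≤ det3 (toPlane c) (toPlane a) x :=
  mem_convexHull_triple (by rw [← cast_orientDet]; exact_mod_cast h) x

lemma range_toPlane_vertex (T : LatticeTriangle) :
    (Set.range fun i => toPlane (T.vertex i)) =
      {toPlane (T.vertex 0), toPlane (T.vertex 1), toPlane (T.vertex 2)} := by
  ext x
  simp [Fin.exists_fin_succ, eq_comm]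

lemma LatticeTriangle.region_eq (T : LatticeTriangle) :
    T.region = tri (T.vertex 0) (T.vertex 1) (T.vertex 2) := by
  rw [LatticeTriangle.region, range_toPlane_vertex, tri]

lemma exists_pos_smul_mem {U : Set (ℝ × ℝ)} (hU : IsOpen U) {x : ℝ × ℝ} (hx : x ∈ U)
    (v : ℝ × ℝ) : ∃ ε : ℝ, 0 < ε ∧ ε ≤ 1 ∧ x + ε • v ∈ U := by
  have hc : Filter.Tendsto (fun ε : ℝ => x + ε • v) (nhdsWithin 0 (Set.Ioi 0)) (nhds x) := by
    have : Continuous (fun ε : ℝ => x + ε • v) := by fun_prop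
    have := this.tendsto 0
    simp only [zero_smul, add_zero] at this
    exact this.mono_left nhdsWithin_le_nhds
  have h1 := hc.eventually (hU.mem_nhds hx)
  have h2 : ∀ᶠ ε : ℝ in nhdsWithin 0 (Set.Ioi 0), ε ∈ Set.Ioc (0 : ℝ) 1 :=
    Ioc_mem_nhdsGT one_pos
  obtain ⟨ε, h3, h4⟩ := (h1.and h2).exists
  exact ⟨ε, h4.1, h4.2, h3⟩

/-- Sets on different sides of a line have disjoint interiors. -/
lemma disjoint_interior_of_det3 {a b : ℝ × ℝ} (hab : a ≠ b) {A B : Set (ℝ × ℝ)}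
    (hA : ∀ x ∈ A, 0 ≤ det3 a b x) (hB : ∀ x ∈ B, det3 a b x ≤ 0) :
    Disjoint (interior A) (interior B) := by
  rw [Set.disjoint_left]
  intro x hxA hxB
  obtain ⟨ε, hε, -, h⟩ := exists_pos_smul_mem (isOpen_interior.inter isOpen_interior) ⟨hxA, hxB⟩
    (-(b.2 - a.2), b.1 - a.1)
  have h1 := hB _ (interior_subset h.2)
  have h2 := hA _ (interior_subset hxA)
  have h3 : det3 a b (x + ε • (-(b.2 - a.2), b.1 - a.1)) =
      det3 a b x + ε * ((b.1 - a.1) ^ 2 + (b.2 - a.2) ^ 2) := by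
    simp only [det3, Prod.fst_add, Prod.snd_add, Prod.smul_fst, Prod.smul_snd, smul_eq_mul]
    ring
  have h4 : 0 < (b.1 - a.1) ^ 2 + (b.2 - a.2) ^ 2 := by
    by_contra h5
    refine hab (Prod.ext ?_ ?_) <;> nlinarith [sq_nonneg (b.1 - a.1), sq_nonneg (b.2 - a.2)]
  have := mul_pos hε h4
  linarith

lemma even_orientDet_iff (a b c : ℤ × ℤ) : Even (orientDet a b c) ↔
    ¬ (parityColor a ≠ parityColor b ∧ parityColor b ≠ parityColor c ∧
      parityColor a ≠ parityColor c) := by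
  rw [← ZMod.intCast_eq_zero_iff_even, orientDet_eq]
  simp only [parityColor]
  push_cast
  generalize (a.1 : ZMod 2) = a1, (a.2 : ZMod 2) = a2, (b.1 : ZMod 2) = b1,
    (b.2 : ZMod 2) = b2, (c.1 : ZMod 2) = c1, (c.2 : ZMod 2) = c2
  revert a1 a2 b1 b2 c1 c2
  decide

lemma LatticeTriangle.isInt_area_iff (T : LatticeTriangle) : (∃ k : ℤ, T.area = k) ↔
    Even (orientDet (T.vertex 0) (T.vertex 1) (T.vertex 2)) := by
  rw [LatticeTriangle.area, ← even_abs]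
  constructor
  · rintro ⟨k, hk⟩
    rw [div_eq_iff two_ne_zero] at hk
    exact ⟨k, by have : ((|orientDet (T.vertex 0) (T.vertex 1) (T.vertex 2)| : ℤ) : ℝ) =
      ((k + k : ℤ) : ℝ) := by (push_cast; rw [hk]; ring)
                 exact_mod_cast this⟩
  · rintro ⟨k, hk⟩
    refine ⟨k, ?_⟩
    rw [← Int.cast_abs, hk]
    push_cast
    ring

/-! ### Dissections as lists of triangles -/

/-- The triangles in the list cover the set `S` exactly, without overlaps. -/
structure IsTiling (S : Set (ℝ × ℝ)) (ts : List LatticeTriangle) : Prop where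
  mem_iff : ∀ x, x ∈ S ↔ ∃ T ∈ ts, x ∈ T.region
  pairwise : ts.Pairwise fun T T' => Disjoint (interior T.region) (interior T'.region)

lemma IsTiling.subset {S : Set (ℝ × ℝ)} {ts : List LatticeTriangle} (h : IsTiling S ts)
    {T : LatticeTriangle} (hT : T ∈ ts) : T.region ⊆ S :=
  fun x hx => (h.mem_iff x).2 ⟨T, hT, hx⟩

lemma IsTiling.append {S S' : Set (ℝ × ℝ)} {ts ts' : List LatticeTriangle} (h : IsTiling S ts)
    (h' : IsTiling S' ts') (hd : Disjoint (interior S) (interior S')) :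
    IsTiling (S ∪ S') (ts ++ ts') where
  mem_iff x := by
    simp only [Set.mem_union, h.mem_iff, h'.mem_iff, List.mem_append]
    aesop
  pairwise := List.pairwise_append.2 ⟨h.pairwise, h'.pairwise, fun _ hT _ hT' =>
    hd.mono (interior_mono (h.subset hT)) (interior_mono (h'.subset hT'))⟩

/-- Dissecting the triangles of a dissection. -/
lemma IsTiling.refine {S : Set (ℝ × ℝ)} {ts : List LatticeTriangle} (h : IsTiling S ts)
    {Q : LatticeTriangle → Prop}
    (hQ : ∀ T ∈ ts, ∃ us, IsTiling T.region us ∧ ∀ U ∈ us, Q U) :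
    ∃ us, IsTiling S us ∧ ∀ U ∈ us, Q U := by
  have : ∀ T, ∃ us, T ∈ ts → IsTiling T.region us ∧ ∀ U ∈ us, Q U := fun T => by
    by_cases hT : T ∈ ts
    · obtain ⟨us, hus⟩ := hQ T hT
      exact ⟨us, fun _ => hus⟩
    · exact ⟨[], fun h => absurd h hT⟩
  choose f hf using this
  refine ⟨ts.flatMap f, ⟨fun x => ?_, ?_⟩, ?_⟩
  · rw [h.mem_iff]
    constructor
    · rintro ⟨T, hT, hx⟩
      obtain ⟨U, hU, hxU⟩ := ((hf T hT).1.mem_iff x).1 hx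
      exact ⟨U, List.mem_flatMap.2 ⟨T, hT, hU⟩, hxU⟩
    · rintro ⟨U, hU, hxU⟩
      obtain ⟨T, hT, hU⟩ := List.mem_flatMap.1 hU
      exact ⟨T, hT, (hf T hT).1.subset hU hxU⟩
  · rw [List.pairwise_flatMap]
    refine ⟨fun T hT => (hf T hT).1.pairwise, ?_⟩
    refine h.pairwise.imp_of_mem fun {T T'} hT hT' hd U hU U' hU' => ?_
    exact hd.mono (interior_mono ((hf T hT).1.subset hU)) (interior_mono ((hf T' hT').1.subset hU'))
  · intro U hU
    obtain ⟨T, hT, hU⟩ := List.mem_flatMap.1 hU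
    exact (hf T hT).2 U hU

/-- The triangle with the given vertices if it is nondegenerate, as a list of length at most `1`. -/
def triangleList (a b c : ℤ × ℤ) : List LatticeTriangle :=
  if h : orientDet a b c ≠ 0 then [⟨![a, b, c], h⟩] else []

lemma mem_triangleList {a b c : ℤ × ℤ} {T : LatticeTriangle} : T ∈ triangleList a b c ↔
    orientDet a b c ≠ 0 ∧ T.vertex = ![a, b, c] := by
  unfold triangleList
  split_ifs with h
  · obtain ⟨v, hv⟩ := T
    simp only [List.mem_singleton, ne_eq, h, not_false_eq_true, true_and]
    exact ⟨fun e => by cases e; rfl, fun e => by subst e; rfl⟩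
  · simp [h]

lemma region_of_mem_triangleList {a b c : ℤ × ℤ} {T : LatticeTriangle}
    (hT : T ∈ triangleList a b c) : T.region = tri a b c := by
  rw [T.region_eq, (mem_triangleList.1 hT).2]
  rfl

lemma pairwise_triangleList {R : LatticeTriangle → LatticeTriangle → Prop} (a b c : ℤ × ℤ) :
    (triangleList a b c).Pairwise R := by
  unfold triangleList
  split_ifs <;> simp

lemma isTiling_triangleList {a b c : ℤ × ℤ} (h : 0 < orientDet a b c) :
    IsTiling (tri a b c) (triangleList a b c) where
  mem_iff x := by
    constructor
    · intro hx
      have hT : (⟨![a, b, c], h.ne'⟩ : LatticeTriangle) ∈ triangleList a b c :=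
        mem_triangleList.2 ⟨h.ne', rfl⟩
      exact ⟨_, hT, by rwa [region_of_mem_triangleList hT]⟩
    · rintro ⟨T, hT, hx⟩
      rwa [region_of_mem_triangleList hT] at hx
  pairwise := pairwise_triangleList a b c

/-- Among finitely many quotients of nonnegative numbers one is the least, in a form which ignores
vanishing denominators. -/
lemma exists_min_ratio {ι : Type} [Fintype ι] {f w : ι → ℝ} (hf : ∀ i, 0 ≤ f i)
    (hw : ∀ i, 0 ≤ w i) (h : ∃ i, w i ≠ 0) : ∃ i, 0 < w i ∧ ∀ j, f i * w j ≤ f j * w i := by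
  classical
  obtain ⟨k, hk⟩ := h
  obtain ⟨i, hi, hmin⟩ := (Finset.univ.filter fun i => 0 < w i).exists_min_image
    (fun i => f i / w i) ⟨k, by simpa using lt_of_le_of_ne (hw k) hk.symm⟩
  have hi : 0 < w i := by simpa using hi
  refine ⟨i, hi, fun j => ?_⟩
  rcases (hw j).eq_or_lt with hj | hj
  · rw [← hj, mul_zero]
    exact mul_nonneg (hf j) hi.le
  · exact (div_le_div_iff₀ hi hj).1 (hmin j (by simpa using hj))

lemma tri_subset {b c d : ℤ × ℤ} {S : Set (ℝ × ℝ)} (hS : Convex ℝ S) (hd : toPlane d ∈ S)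
    (hb : toPlane b ∈ S) (hc : toPlane c ∈ S) : tri d b c ⊆ S := by
  refine convexHull_min ?_ hS
  rintro y (rfl | rfl | rfl) <;> assumption

lemma det3_mul_det3 (a b c d q : ℝ × ℝ) : det3 a b c * det3 d b q =
    det3 d b c * det3 a b q - det3 d a b * det3 b c q := by
  simp only [det3]; ring

lemma mem_tri_of_ratio {a b c d : ℤ × ℤ} (h : 0 < orientDet a b c) (hd : 0 < orientDet d b c)
    {q : ℝ × ℝ} (hq : 0 ≤ det3 (toPlane b) (toPlane c) q)
    (h1 : det3 (toPlane b) (toPlane c) q * orientDet d a b ≤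
      det3 (toPlane a) (toPlane b) q * orientDet d b c)
    (h2 : det3 (toPlane b) (toPlane c) q * orientDet d c a ≤
      det3 (toPlane c) (toPlane a) q * orientDet d b c) : q ∈ tri d b c := by
  have h' : (0 : ℝ) < orientDet a b c := by exact_mod_cast h
  rw [mem_tri hd]
  refine ⟨?_, hq, ?_⟩
  · refine nonneg_of_mul_nonneg_right ?_ h'
    rw [cast_orientDet, det3_mul_det3, ← cast_orientDet, ← cast_orientDet]
    linarith
  · refine nonneg_of_mul_nonneg_right ?_ h'
    have h3 : det3 (toPlane a) (toPlane b) (toPlane c) * det3 (toPlane c) (toPlane d) q =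
        det3 (toPlane d) (toPlane b) (toPlane c) * det3 (toPlane c) (toPlane a) q -
        det3 (toPlane d) (toPlane c) (toPlane a) * det3 (toPlane b) (toPlane c) q := by
      simp only [det3]; ring
    rw [cast_orientDet, h3, ← cast_orientDet, ← cast_orientDet]
    linarith

lemma disjoint_interior_tri {a b c d : ℤ × ℤ} (hdc : d ≠ c) (h1 : 0 < orientDet d b c)
    (h2 : 0 < orientDet d c a) : Disjoint (interior (tri d b c)) (interior (tri d c a)) := by
  refine (disjoint_interior_of_det3 (a := toPlane d) (b := toPlane c)
    (fun h => hdc (toPlane_injective h)) ?_ ?_).symm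
  · exact fun x hx => ((mem_tri h2 x).1 hx).1
  · intro x hx
    have := ((mem_tri h1 x).1 hx).2.2
    rw [det3_swap]
    linarith

/-- A triangle is cut into at most three triangles by a point different from its vertices. -/
lemma isTiling_split {a b c d : ℤ × ℤ} (ha : 0 ≤ orientDet d b c) (hb : 0 ≤ orientDet d c a)
    (hc : 0 ≤ orientDet d a b) (ha' : orientDet d b c < orientDet a b c)
    (hb' : orientDet d c a < orientDet a b c) (hc' : orientDet d a b < orientDet a b c) :
    IsTiling (tri a b c) (triangleList d b c ++ triangleList d c a ++ triangleList d a b) := by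
  have hS : 0 < orientDet a b c := ha.trans_lt ha'
  have hsum : orientDet d b c + orientDet d c a + orientDet d a b = orientDet a b c := by
    simp only [orientDet_eq]; ring
  have r1 : orientDet b c a = orientDet a b c := orientDet_rotate a b c
  have r2 : orientDet c a b = orientDet a b c := by rw [← orientDet_rotate]
  have wa : (0 : ℝ) ≤ orientDet d b c := by exact_mod_cast ha
  have wb : (0 : ℝ) ≤ orientDet d c a := by exact_mod_cast hb
  have wc : (0 : ℝ) ≤ orientDet d a b := by exact_mod_cast hc
  have hda : d ≠ a := by rintro rfl; omega
  have hdb : d ≠ b := by rintro rfl; omega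
  have hdc : d ≠ c := by rintro rfl; omega
  have hd : toPlane d ∈ tri a b c := by
    rw [mem_tri hS, ← cast_orientDet, ← cast_orientDet, ← cast_orientDet]
    rw [orientDet_rotate d a b, orientDet_rotate d b c, orientDet_rotate d c a]
    exact ⟨by exact_mod_cast hc, by exact_mod_cast ha, by exact_mod_cast hb⟩
  have hconv : Convex ℝ (tri a b c) := convex_convexHull _ _
  have va : toPlane a ∈ tri a b c := subset_convexHull _ _ (by simp)
  have vb : toPlane b ∈ tri a b c := subset_convexHull _ _ (by simp)
  have vc : toPlane c ∈ tri a b c := subset_convexHull _ _ (by simp)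
  have hmem : ∀ {p q r : ℤ × ℤ} {T : LatticeTriangle}, T ∈ triangleList p q r →
      orientDet p q r ≠ 0 ∧ T.region = tri p q r := fun h =>
    ⟨(mem_triangleList.1 h).1, region_of_mem_triangleList h⟩
  constructor
  · intro q
    constructor
    · intro hq
      obtain ⟨hC, hA, hB⟩ := (mem_tri hS q).1 hq
      obtain ⟨i, hi, hj⟩ := exists_min_ratio
        (f := ![det3 (toPlane b) (toPlane c) q, det3 (toPlane c) (toPlane a) q,
          det3 (toPlane a) (toPlane b) q])
        (w := ![(orientDet d b c : ℝ), (orientDet d c a : ℝ), (orientDet d a b : ℝ)])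
        (by intro i; fin_cases i; exacts [hA, hB, hC])
        (by intro i; fin_cases i; exacts [wa, wb, wc])
        (by
          by_contra! h
          have h0 := h 0
          have h1 := h 1
          have h2 := h 2
          simp at h0 h1 h2
          omega)
      have hj0 := hj 0
      have hj1 := hj 1
      have hj2 := hj 2
      have fin : ∀ {x y z : ℤ × ℤ}, 0 < orientDet x y z → q ∈ tri x y z →
          ∃ T ∈ triangleList x y z, q ∈ T.region := fun h hq =>
        ((isTiling_triangleList h).mem_iff q).1 hq
      fin_cases i <;> simp at hi hj0 hj1 hj2
      · obtain ⟨T, hT, hx⟩ := fin hi (mem_tri_of_ratio hS hi hA hj2 hj1)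
        exact ⟨T, by simp [hT], hx⟩
      · obtain ⟨T, hT, hx⟩ := fin hi (mem_tri_of_ratio (by rw [r1]; exact hS) hi hB hj0 hj2)
        exact ⟨T, by simp [hT], hx⟩
      · obtain ⟨T, hT, hx⟩ := fin hi (mem_tri_of_ratio (by rw [r2]; exact hS) hi hC hj1 hj0)
        exact ⟨T, by simp [hT], hx⟩
    · rintro ⟨T, hT, hx⟩
      simp only [List.mem_append, or_assoc] at hT
      rcases hT with hT | hT | hT <;> rw [(hmem hT).2] at hx
      · exact tri_subset hconv hd vb vc hx
      · exact tri_subset hconv hd vc va hx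
      · exact tri_subset hconv hd va vb hx
  · rw [List.pairwise_append, List.pairwise_append]
    refine ⟨⟨pairwise_triangleList _ _ _, pairwise_triangleList _ _ _, ?_⟩,
      pairwise_triangleList _ _ _, ?_⟩
    · intro T hT T' hT'
      rw [(hmem hT).2, (hmem hT').2]
      exact disjoint_interior_tri hdc (lt_of_le_of_ne ha (hmem hT).1.symm)
        (lt_of_le_of_ne hb (hmem hT').1.symm)
    · intro T hT T' hT'
      have h3 := lt_of_le_of_ne hc (hmem hT').1.symm
      rcases List.mem_append.1 hT with hT | hT <;> rw [(hmem hT).2, (hmem hT').2]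
      · exact (disjoint_interior_tri hdb h3 (lt_of_le_of_ne ha (hmem hT).1.symm)).symm
      · exact disjoint_interior_tri hda (lt_of_le_of_ne hb (hmem hT).1.symm) h3

/-! ### Triangles of integer area are dissected into triangles of area `1` -/

/-- The conclusion of `exists_splitting_point` when two given vertices have the same colour: if their
midpoint does not do, then the area of the triangle is odd and at least `3`. The
vectors from `b` to the lattice points with the colour of a vertex then form a lattice in which the
one generated by the sides is a proper sublattice, and a vector outside the latter is moved into the
parallelogram, and by reflection into the triangle. -/
lemma exists_splitting_point_aux {a b c : ℤ × ℤ} (h4 : 4 ≤ orientDet a b c)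
    (he : Even (orientDet a b c)) (hbc : parityColor b = parityColor c) :
    ∃ d, (Even (orientDet d b c) ∧ Even (orientDet d c a) ∧ Even (orientDet d a b)) ∧
      (0 ≤ orientDet d b c ∧ 0 ≤ orientDet d c a ∧ 0 ≤ orientDet d a b) ∧
      orientDet d b c < orientDet a b c ∧ orientDet d c a < orientDet a b c ∧
      orientDet d a b < orientDet a b c := by
  obtain ⟨a1, a2⟩ := a
  obtain ⟨b1, b2⟩ := b
  obtain ⟨c1, c2⟩ := c
  simp only [parityColor, Prod.mk.injEq, ZMod.intCast_eq_intCast_iff_dvd_sub] at hbc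
  obtain ⟨⟨u1, hu1⟩, ⟨u2, hu2⟩⟩ := hbc
  obtain rfl : c1 = b1 + 2 * u1 := by push_cast at hu1; linarith
  obtain rfl : c2 = b2 + 2 * u2 := by push_cast at hu2; linarith
  obtain ⟨w1, rfl⟩ : ∃ w1, a1 = b1 + w1 := ⟨a1 - b1, by ring⟩
  obtain ⟨w2, rfl⟩ : ∃ w2, a2 = b2 + w2 := ⟨a2 - b2, by ring⟩
  obtain ⟨k, hk⟩ : ∃ k, k = u1 * w2 - u2 * w1 := ⟨_, rfl⟩
  have hS : orientDet (b1 + w1, b2 + w2) (b1, b2) (b1 + 2 * u1, b2 + 2 * u2) = 2 * k := by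
    rw [orientDet_eq, hk]; ring
  rw [hS] at h4 ⊢
  -- the areas of the three parts for the point `b + v`
  have hx : ∀ v1 v2, orientDet (b1 + v1, b2 + v2) (b1, b2) (b1 + 2 * u1, b2 + 2 * u2) =
      2 * (u1 * v2 - u2 * v1) := fun v1 v2 => by rw [orientDet_eq]; ring
  have hz : ∀ v1 v2, orientDet (b1 + v1, b2 + v2) (b1 + w1, b2 + w2) (b1, b2) =
      v1 * w2 - v2 * w1 := fun v1 v2 => by rw [orientDet_eq]; ring
  have hy : ∀ v1 v2, orientDet (b1 + v1, b2 + v2) (b1 + 2 * u1, b2 + 2 * u2) (b1 + w1, b2 + w2) =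
      2 * k - 2 * (u1 * v2 - u2 * v1) - (v1 * w2 - v2 * w1) := fun v1 v2 => by
    rw [orientDet_eq, hk]; ring
  have hgen : ∀ v1 v2 x z : ℤ, 2 * (u1 * v2 - u2 * v1) = x → v1 * w2 - v2 * w1 = z → Even x →
      Even z → 0 ≤ x → 0 ≤ z → x + z ≤ 2 * k → 0 < x + z → x < 2 * k → z < 2 * k →
      ∃ d, (Even (orientDet d (b1, b2) (b1 + 2 * u1, b2 + 2 * u2)) ∧
          Even (orientDet d (b1 + 2 * u1, b2 + 2 * u2) (b1 + w1, b2 + w2)) ∧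
          Even (orientDet d (b1 + w1, b2 + w2) (b1, b2))) ∧
        (0 ≤ orientDet d (b1, b2) (b1 + 2 * u1, b2 + 2 * u2) ∧
          0 ≤ orientDet d (b1 + 2 * u1, b2 + 2 * u2) (b1 + w1, b2 + w2) ∧
          0 ≤ orientDet d (b1 + w1, b2 + w2) (b1, b2)) ∧
        orientDet d (b1, b2) (b1 + 2 * u1, b2 + 2 * u2) < 2 * k ∧
        orientDet d (b1 + 2 * u1, b2 + 2 * u2) (b1 + w1, b2 + w2) < 2 * k ∧
        orientDet d (b1 + w1, b2 + w2) (b1, b2) < 2 * k := by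
    intro v1 v2 x z h1 h2 e1 e2 p1 p2 p3 p4 p5 p6
    refine ⟨(b1 + v1, b2 + v2), ?_⟩
    rw [hx, hy, hz, h1, h2]
    refine ⟨⟨e1, ?_, e2⟩, ⟨p1, by omega, p2⟩, p5, by omega, p6⟩
    rw [Int.even_iff] at e1 e2 ⊢
    omega
  rcases Int.even_or_odd k with hke | hko
  · refine hgen u1 u2 0 k (by ring) hk.symm (by simp) hke ?_ ?_ ?_ ?_ ?_ ?_ <;> omega
  -- an element `(e1, e2)` of `2ℤ²` outside the lattice generated by the sides
  obtain ⟨e1, e2, he1, he2, hne⟩ : ∃ e1 e2 : ℤ, Even e1 ∧ Even e2 ∧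
      ¬ (2 * k ∣ 2 * (u1 * e2 - u2 * e1) ∧ 2 * k ∣ e1 * w2 - e2 * w1) := by
    by_contra! h
    have h1 := h 2 0 (by decide) (by decide)
    have h2 := h 0 2 (by decide) (by decide)
    have hcop : IsCoprime k 2 := by
      rw [Int.isCoprime_iff_gcd_eq_one, Int.gcd_comm]
      exact Int.isCoprime_iff_gcd_eq_one.1 (Int.isCoprime_two_left.2 hko)
    have hd : ∀ x : ℤ, 2 * k ∣ 2 * (2 * x) → k ∣ x := fun x hx =>
      hcop.dvd_of_dvd_mul_left ((mul_dvd_mul_iff_left two_ne_zero).1 hx)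
    obtain ⟨s2, hs2⟩ : k ∣ u2 := hd u2 (by
      have := h1.1
      rwa [show 2 * (u1 * 0 - u2 * 2) = -(2 * (2 * u2)) by ring, dvd_neg] at this)
    obtain ⟨s1, hs1⟩ : k ∣ u1 := hd u1 (by
      have := h2.1
      rwa [show 2 * (u1 * 2 - u2 * 0) = 2 * (2 * u1) by ring] at this)
    obtain ⟨t2, ht2⟩ : k ∣ w2 := by
      have := h1.2
      rw [zero_mul, sub_zero] at this
      exact (mul_dvd_mul_iff_left two_ne_zero).1 this
    obtain ⟨t1, ht1⟩ : k ∣ w1 := by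
      have := h2.2
      rw [zero_mul, zero_sub, dvd_neg] at this
      exact (mul_dvd_mul_iff_left two_ne_zero).1 this
    have hk1 : k * (k * (s1 * t2 - s2 * t1)) = k * 1 := by
      rw [hs1, hs2, ht1, ht2] at hk
      linear_combination -hk
    have hk2 := mul_left_cancel₀ (by omega) hk1
    have := Int.eq_one_or_neg_one_of_mul_eq_one hk2
    omega
  obtain ⟨m1, hm1⟩ : ∃ m1, m1 = 2 * (u1 * e2 - u2 * e1) := ⟨_, rfl⟩
  obtain ⟨m2, hm2⟩ : ∃ m2, m2 = e1 * w2 - e2 * w1 := ⟨_, rfl⟩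
  rw [← hm1, ← hm2] at hne
  have hm1e : Even m1 := by rw [hm1]; exact even_two_mul _
  have hm2e : Even m2 := by rw [hm2]; exact (he1.mul_right _).sub (he2.mul_right _)
  have d1 := Int.emod_add_mul_ediv m1 (2 * k)
  have d2 := Int.emod_add_mul_ediv m2 (2 * k)
  have p1 := Int.emod_nonneg m1 (show 2 * k ≠ 0 by omega)
  have p2 := Int.emod_nonneg m2 (show 2 * k ≠ 0 by omega)
  have q1 := Int.emod_lt_of_pos m1 (show 0 < 2 * k by omega)
  have q2 := Int.emod_lt_of_pos m2 (show 0 < 2 * k by omega)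
  rw [Int.dvd_iff_emod_eq_zero, Int.dvd_iff_emod_eq_zero] at hne
  generalize m1 % (2 * k) = r1 at *
  generalize m2 % (2 * k) = r2 at *
  generalize m1 / (2 * k) = s1 at *
  generalize m2 / (2 * k) = s2 at *
  have hr1 : Even r1 := by
    have : r1 = m1 - 2 * (k * s1) := by linarith
    rw [this]; exact hm1e.sub (even_two_mul _)
  have hr2 : Even r2 := by
    have : r2 = m2 - 2 * (k * s2) := by linarith
    rw [this]; exact hm2e.sub (even_two_mul _)
  -- `z = (e1, e2) - s2 * 2u - s1 * w` lies in the half-open parallelogram spanned by the sides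
  have f1 : 2 * (u1 * (e2 - s2 * (2 * u2) - s1 * w2) - u2 * (e1 - s2 * (2 * u1) - s1 * w1)) =
      r1 := by linear_combination -hm1 - d1 + 2 * s1 * hk
  have f2 : (e1 - s2 * (2 * u1) - s1 * w1) * w2 - (e2 - s2 * (2 * u2) - s1 * w2) * w1 = r2 := by
    linear_combination -hm2 - d2 + 2 * s2 * hk
  have hpos : 0 < r1 + r2 := by omega
  rcases le_or_gt (r1 + r2) (2 * k) with hle | hgt
  · exact hgen _ _ r1 r2 f1 f2 hr1 hr2 p1 p2 hle hpos q1 q2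
  · have hk2 : Even (2 * k) := even_two_mul k
    refine hgen (2 * u1 + w1 - (e1 - s2 * (2 * u1) - s1 * w1))
      (2 * u2 + w2 - (e2 - s2 * (2 * u2) - s1 * w2)) (2 * k - r1) (2 * k - r2) ?_ ?_
      (hk2.sub hr1) (hk2.sub hr2) ?_ ?_ ?_ ?_ ?_ ?_
    · linear_combination -f1 - 2 * hk
    · linear_combination -f2 - 2 * hk
    all_goals omega

/-- A triangle of integer area at least `2` is cut into triangles of smaller integer area by some
lattice point. -/
lemma exists_splitting_point {a b c : ℤ × ℤ} (h4 : 4 ≤ orientDet a b c)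
    (he : Even (orientDet a b c)) :
    ∃ d, (Even (orientDet d b c) ∧ Even (orientDet d c a) ∧ Even (orientDet d a b)) ∧
      (0 ≤ orientDet d b c ∧ 0 ≤ orientDet d c a ∧ 0 ≤ orientDet d a b) ∧
      orientDet d b c < orientDet a b c ∧ orientDet d c a < orientDet a b c ∧
      orientDet d a b < orientDet a b c := by
  have r1 : orientDet b c a = orientDet a b c := orientDet_rotate a b c
  have r2 : orientDet c a b = orientDet a b c := by rw [← orientDet_rotate]
  by_cases hbc : parityColor b = parityColor c
  · exact exists_splitting_point_aux h4 he hbc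
  by_cases hca : parityColor c = parityColor a
  · obtain ⟨d, ⟨e1, e2, e3⟩, ⟨p1, p2, p3⟩, q1, q2, q3⟩ := exists_splitting_point_aux (a := b)
      (by rw [r1]; exact h4) (by rw [r1]; exact he) hca
    rw [r1] at q1 q2 q3
    exact ⟨d, ⟨e3, e1, e2⟩, ⟨p3, p1, p2⟩, q3, q1, q2⟩
  by_cases hab : parityColor a = parityColor b
  · obtain ⟨d, ⟨e1, e2, e3⟩, ⟨p1, p2, p3⟩, q1, q2, q3⟩ := exists_splitting_point_aux (a := c)
      (by rw [r2]; exact h4) (by rw [r2]; exact he) hab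
    rw [r2] at q1 q2 q3
    exact ⟨d, ⟨e2, e3, e1⟩, ⟨p2, p3, p1⟩, q2, q3, q1⟩
  exact absurd ⟨hab, hbc, fun h => hca h.symm⟩ ((even_orientDet_iff a b c).1 he)

lemma exists_unit_tiling_tri (n : ℕ) : ∀ a b c : ℤ × ℤ, 0 < orientDet a b c →
    Even (orientDet a b c) → orientDet a b c ≤ n →
    ∃ ts, IsTiling (tri a b c) ts ∧ ∀ T ∈ ts, T.area = 1 := by
  induction n with
  | zero => intro a b c h _ h'; simp at h'; omega
  | succ n ih =>
    intro a b c hpos he hn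
    by_cases h2 : orientDet a b c = 2
    · refine ⟨_, isTiling_triangleList hpos, fun T hT => ?_⟩
      rw [LatticeTriangle.area, (mem_triangleList.1 hT).2]
      simp [h2]
    have h4 : 4 ≤ orientDet a b c := by
      obtain ⟨k, hk⟩ := he
      omega
    obtain ⟨d, ⟨e1, e2, e3⟩, ⟨p1, p2, p3⟩, q1, q2, q3⟩ := exists_splitting_point h4 he
    refine (isTiling_split p1 p2 p3 q1 q2 q3).refine ?_
    have key : ∀ {x y z : ℤ × ℤ} {T : LatticeTriangle}, T ∈ triangleList x y z →
        Even (orientDet x y z) → 0 ≤ orientDet x y z → orientDet x y z < orientDet a b c →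
        ∃ us, IsTiling T.region us ∧ ∀ U ∈ us, U.area = 1 := by
      intro x y z T hT e p q
      rw [region_of_mem_triangleList hT]
      exact ih x y z (lt_of_le_of_ne p (mem_triangleList.1 hT).1.symm) e (by push_cast at hn; omega)
    intro T hT
    simp only [List.mem_append, or_assoc] at hT
    rcases hT with hT | hT | hT
    · exact key hT e1 p1 q1
    · exact key hT e2 p2 q2
    · exact key hT e3 p3 q3

lemma tri_swap (a b c : ℤ × ℤ) : tri a c b = tri a b c := by
  rw [tri, tri, Set.pair_comm]

lemma orientDet_swap (a b c : ℤ × ℤ) : orientDet a c b = -orientDet a b c := by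
  simp only [orientDet_eq]; ring

/-- The vertices of a triangle in counterclockwise order. -/
lemma LatticeTriangle.exists_counterclockwise (T : LatticeTriangle) :
    ∃ V : Fin 3 → ℤ × ℤ, 0 < orientDet (V 0) (V 1) (V 2) ∧ T.region = tri (V 0) (V 1) (V 2) ∧
      orientDet (V 0) (V 1) (V 2) = |orientDet (T.vertex 0) (T.vertex 1) (T.vertex 2)| := by
  rcases T.nondegenerate.lt_or_gt with h | h
  · refine ⟨![T.vertex 0, T.vertex 2, T.vertex 1], ?_, ?_, ?_⟩
    · change 0 < orientDet (T.vertex 0) (T.vertex 2) (T.vertex 1)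
      rw [orientDet_swap]
      omega
    · exact T.region_eq.trans (tri_swap _ _ _).symm
    · change orientDet (T.vertex 0) (T.vertex 2) (T.vertex 1) = _
      rw [orientDet_swap, abs_of_neg h]
  · exact ⟨T.vertex, h, T.region_eq, (abs_of_pos h).symm⟩

/-- A lattice triangle of integer area is dissected into lattice triangles of area `1`. -/
theorem LatticeTriangle.exists_unit_tiling (T : LatticeTriangle) (h : ∃ k : ℤ, T.area = k) :
    ∃ ts, IsTiling T.region ts ∧ ∀ U ∈ ts, U.area = 1 := by
  rw [T.isInt_area_iff, ← even_abs] at h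
  obtain ⟨V, hV, hr, hd⟩ := T.exists_counterclockwise
  rw [hr]
  exact exists_unit_tiling_tri (orientDet (V 0) (V 1) (V 2)).toNat _ _ _ hV
    (by rw [hd]; exact h) (by omega)

/-! ### Cutting off ears -/

/-- The convex hull of the points of a list. -/
def hullOf (L : List (ℤ × ℤ)) : Set (ℝ × ℝ) := convexHull ℝ (toPlane '' {a | a ∈ L})

/-- The points of the list are the corners of a convex polygon in counterclockwise order. -/
def IsCCW (L : List (ℤ × ℤ)) : Prop :=
  ∀ a b c, [a, b, c].Sublist L → 0 < orientDet a b c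

lemma convex_hullOf (L : List (ℤ × ℤ)) : Convex ℝ (hullOf L) := convex_convexHull _ _

lemma toPlane_mem_hullOf {L : List (ℤ × ℤ)} {a : ℤ × ℤ} (h : a ∈ L) : toPlane a ∈ hullOf L :=
  subset_convexHull _ _ ⟨a, h, rfl⟩

lemma hullOf_subset {L : List (ℤ × ℤ)} {S : Set (ℝ × ℝ)} (hS : Convex ℝ S)
    (h : ∀ a ∈ L, toPlane a ∈ S) : hullOf L ⊆ S := by
  refine convexHull_min ?_ hS
  rintro _ ⟨a, ha, rfl⟩
  exact h a ha

lemma hullOf_congr {L M : List (ℤ × ℤ)} (h : ∀ a, a ∈ L ↔ a ∈ M) : hullOf L = hullOf M := by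
  simp only [hullOf, h]

lemma hullOf_triple (a b c : ℤ × ℤ) : hullOf [a, b, c] = tri a b c := by
  rw [hullOf, tri]
  congr 1
  ext x
  simp [eq_comm]

lemma IsCCW.sublist {L M : List (ℤ × ℤ)} (h : IsCCW L) (hM : M.Sublist L) : IsCCW M :=
  fun a b c habc => h a b c (habc.trans hM)

lemma IsCCW.rotate_one {x : ℤ × ℤ} {l : List (ℤ × ℤ)} (h : IsCCW (x :: l)) : IsCCW (l ++ [x]) := by
  intro a b c habc
  rw [List.sublist_append_iff] at habc
  obtain ⟨l₁, l₂, h12, h1, h2⟩ := habc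
  rcases List.sublist_singleton.1 h2 with rfl | rfl
  · rw [List.append_nil] at h12
    subst h12
    exact h a b c (h1.trans (List.sublist_cons_self x l))
  · have h3 : [a, b] ++ [c] = l₁ ++ [x] := h12
    obtain ⟨rfl, h4⟩ := List.append_inj' h3 rfl
    obtain rfl : c = x := by simpa using h4
    rw [orientDet_rotate]
    exact h c a b (h1.cons_cons c)

lemma IsCCW.rotate (n : ℕ) : ∀ {l : List (ℤ × ℤ)}, IsCCW l → IsCCW (l.rotate n) := by
  induction n with
  | zero => intro l h; simpa using h
  | succ n ih =>
    intro l h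
    cases l with
    | nil => simpa using h
    | cons x l =>
      rw [List.rotate_cons_succ]
      exact ih h.rotate_one

section Ear

variable {p h e : ℤ × ℤ} {N : List (ℤ × ℤ)}

lemma IsCCW.ear_pos (hc : IsCCW (p :: h :: (N ++ [e]))) : 0 < orientDet p h e :=
  hc p h e ((((List.sublist_append_right N [e])).cons_cons h).cons_cons p)

lemma IsCCW.ear_first (hc : IsCCW (p :: h :: (N ++ [e]))) {y : ℝ × ℝ}
    (hy : y ∈ hullOf (h :: (N ++ [e]))) : 0 ≤ det3 (toPlane p) (toPlane h) y := by
  refine hullOf_subset (convex_det3_nonneg (toPlane p) (toPlane h)) (fun a ha => ?_) hy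
  change 0 ≤ det3 _ _ _
  rcases List.mem_cons.1 ha with rfl | ha
  · simp
  · rw [← cast_orientDet]
    exact_mod_cast (hc p h a ((((List.singleton_sublist.2 ha)).cons_cons h).cons_cons p)).le

lemma IsCCW.ear_last (hc : IsCCW (p :: h :: (N ++ [e]))) {y : ℝ × ℝ}
    (hy : y ∈ hullOf (h :: (N ++ [e]))) : 0 ≤ det3 (toPlane e) (toPlane p) y := by
  refine hullOf_subset (convex_det3_nonneg (toPlane e) (toPlane p)) (fun a ha => ?_) hy
  change 0 ≤ det3 _ _ _
  rw [← List.cons_append] at ha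
  rcases List.mem_append.1 ha with ha | ha
  · rw [← det3_rotate, ← cast_orientDet]
    have h1 : [p, a, e].Sublist (p :: (h :: N) ++ [e]) :=
      ((List.singleton_sublist.2 ha).append (List.Sublist.refl [e])).cons_cons p
    exact_mod_cast (hc p a e h1).le
  · obtain rfl : a = e := by simpa using ha
    simp

lemma IsCCW.ear_base (hc : IsCCW (p :: h :: (N ++ [e]))) {y : ℝ × ℝ}
    (hy : y ∈ hullOf (h :: (N ++ [e]))) : det3 (toPlane h) (toPlane e) y ≤ 0 := by
  refine hullOf_subset (convex_det3_nonpos (toPlane h) (toPlane e)) (fun a ha => ?_) hy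
  change det3 _ _ _ ≤ 0
  rcases List.mem_cons.1 ha with rfl | ha
  · simp
  rcases List.mem_append.1 ha with ha | ha
  · rw [← cast_orientDet, orientDet_swap]
    have h1 : [h, a, e].Sublist (p :: h :: (N ++ [e])) :=
      (((List.singleton_sublist.2 ha).append (List.Sublist.refl [e])).cons_cons h).trans
        (List.sublist_cons_self _ _)
    have := (hc h a e h1).le
    exact_mod_cast neg_nonpos.2 this
  · obtain rfl : a = e := by simpa using ha
    simp

/-- Cutting off an ear of a convex polygon: a point of the polygon that is separated from the ear by
its base lies on a segment from the base to the rest of the polygon. -/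
lemma IsCCW.hullOf_ear (hc : IsCCW (p :: h :: (N ++ [e]))) :
    hullOf (p :: h :: (N ++ [e])) = tri p h e ∪ hullOf (h :: (N ++ [e])) := by
  have hpos := hc.ear_pos
  apply Set.Subset.antisymm
  · intro x hx
    have hne : (toPlane '' {a | a ∈ h :: (N ++ [e])}).Nonempty := ⟨toPlane h, h, by simp, rfl⟩
    have hset : toPlane '' {a | a ∈ p :: h :: (N ++ [e])} =
        insert (toPlane p) (toPlane '' {a | a ∈ h :: (N ++ [e])}) := by
      rw [← Set.image_insert_eq]
      congr 1
      ext a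
      simp
    rw [hullOf, hset, convexHull_insert hne, mem_convexJoin] at hx
    obtain ⟨_, rfl, y, hy, s, t, hs, ht, hst, rfl⟩ := hx
    replace hy : y ∈ hullOf (h :: (N ++ [e])) := hy
    have y1 := hc.ear_first hy
    have y2 := hc.ear_last hy
    have y3 := hc.ear_base hy
    have p3 : 0 < det3 (toPlane h) (toPlane e) (toPlane p) := by
      rw [det3_rotate, ← cast_orientDet]
      exact_mod_cast hpos
    -- points of the segment on the near side of the base belong to the ear
    have near : ∀ s t : ℝ, 0 ≤ s → 0 ≤ t → s + t = 1 →
        0 ≤ det3 (toPlane h) (toPlane e) (s • toPlane p + t • y) →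
        s • toPlane p + t • y ∈ tri p h e := by
      intro s t hs ht hst h0
      rw [mem_tri hpos]
      refine ⟨?_, h0, ?_⟩
      · rw [det3_combination _ _ _ _ hst, det3_self_left]
        simpa using mul_nonneg ht y1
      · rw [det3_combination _ _ _ _ hst, det3_self_right]
        simpa using mul_nonneg ht y2
    by_cases h0 : 0 ≤ det3 (toPlane h) (toPlane e) (s • toPlane p + t • y)
    · exact Or.inl (near s t hs ht hst h0)
    right
    rw [det3_combination _ _ _ _ hst] at h0
    set δ := det3 (toPlane h) (toPlane e) (toPlane p)
    set η := det3 (toPlane h) (toPlane e) y with hη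
    have hη0 : η < 0 := by
      rcases y3.lt_or_eq with h1 | h1
      · exact h1
      · rw [h1] at h0
        exact absurd (by positivity : 0 ≤ s * δ + t * 0) h0
    have hd : 0 < δ - η := by linarith
    -- the point of the segment on the base
    obtain ⟨z, hz⟩ : ∃ z, z = (-η / (δ - η)) • toPlane p + (δ / (δ - η)) • y := ⟨_, rfl⟩
    have hz1 : -η / (δ - η) + δ / (δ - η) = 1 := by field_simp; ring
    have hz0 : det3 (toPlane h) (toPlane e) z = 0 := by
      rw [hz, det3_combination _ _ _ _ hz1]
      field_simp
      ring
    have hzt : z ∈ tri p h e := by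
      rw [hz]
      refine near _ _ (div_nonneg (by linarith) hd.le) (by positivity) hz1 ?_
      rw [← hz, hz0]
    have hzM : z ∈ hullOf (h :: (N ++ [e])) := by
      obtain ⟨z1, -, z2⟩ := (mem_tri hpos z).1 hzt
      have e1 := det3_smul_eq (toPlane p) (toPlane h) (toPlane e) z
      have e2 := det3_add_det3_add_det3 (toPlane p) (toPlane h) (toPlane e) z
      have hD : 0 < det3 (toPlane p) (toPlane h) (toPlane e) := by
        rw [← cast_orientDet]; exact_mod_cast hpos
      rw [hz0, zero_smul, zero_add] at e1
      rw [hz0, zero_add] at e2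
      have e3 : z = (det3 (toPlane e) (toPlane p) z / det3 (toPlane p) (toPlane h) (toPlane e)) •
          toPlane h + (det3 (toPlane p) (toPlane h) z / det3 (toPlane p) (toPlane h) (toPlane e)) •
          toPlane e := by
        rw [div_eq_inv_mul, div_eq_inv_mul, mul_smul, mul_smul, ← smul_add, ← e1, smul_smul,
          inv_mul_cancel₀ hD.ne', one_smul]
      rw [e3]
      refine convex_hullOf _ (toPlane_mem_hullOf (by simp)) (toPlane_mem_hullOf (by simp))
        (by positivity) (by positivity) ?_
      rw [← add_div, e2, div_self hD.ne']
    have hx : s • toPlane p + t • y =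
        (s * (δ - η) / (-η)) • z + (1 - s * (δ - η) / (-η)) • y := by
      have ht' : t = 1 - s := by linarith
      rw [hz, ht', smul_add, smul_smul, smul_smul, add_assoc, ← add_smul]
      have hη' : η ≠ 0 := hη0.ne
      congr 2
      · field_simp
      · field_simp
        ring
    rw [hx]
    have hη' : 0 < -η := by linarith
    refine convex_hullOf _ hzM hy (div_nonneg (mul_nonneg hs hd.le) hη'.le) ?_ (by ring)
    rw [sub_nonneg, div_le_one hη']
    have : t = 1 - s := by linarith
    rw [this] at h0
    push Not at h0
    linarith
  · apply Set.union_subset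
    · exact tri_subset (convex_hullOf _) (toPlane_mem_hullOf (by simp))
        (toPlane_mem_hullOf (by simp)) (toPlane_mem_hullOf (by simp))
    · exact hullOf_subset (convex_hullOf _) fun a ha =>
        toPlane_mem_hullOf (List.mem_cons_of_mem _ ha)

lemma IsCCW.disjoint_ear (hc : IsCCW (p :: h :: (N ++ [e]))) :
    Disjoint (interior (tri p h e)) (interior (hullOf (h :: (N ++ [e])))) := by
  have hpos := hc.ear_pos
  refine disjoint_interior_of_det3 (a := toPlane h) (b := toPlane e) ?_
    (fun x hx => ((mem_tri hpos x).1 hx).2.1) (fun x hx => hc.ear_base hx)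
  intro h0
  rw [toPlane_injective h0, orientDet_eq] at hpos
  exact absurd hpos (by ring_nf; simp)

end Ear

lemma exists_diagonal_tiling_of_contractible (n : ℕ) : ∀ L : List (ℤ × ℤ), L.length = n →
    3 ≤ L.length → IsCCW L → Contractible ((L.map parityColor : List Color) : Cycle Color) →
    ∃ ts, IsTiling (hullOf L) ts ∧ ∀ T ∈ ts, (∀ j, T.vertex j ∈ L) ∧
      Even (orientDet (T.vertex 0) (T.vertex 1) (T.vertex 2)) := by
  induction n using Nat.strong_induction_on with
  | _ n ih =>
    rintro L rfl h3 hc ⟨x, hx⟩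
    rcases hx.cases_head with hx | ⟨w', hstep, hw'⟩
    · rw [Cycle.coe_eq_coe] at hx
      have := hx.perm.length_eq
      simp at this
      omega
    generalize hw : ((L.map parityColor : List Color) : Cycle Color) = w at hstep
    cases hstep with
    | delete c l hl hd =>
      obtain ⟨k, hk⟩ := Cycle.coe_eq_coe.1 hw
      rw [← List.map_rotate] at hk
      have hmem : ∀ a, a ∈ L ↔ a ∈ L.rotate k := fun a => List.mem_rotate.symm
      have hcR := hc.rotate k
      have hlen : (L.rotate k).length = L.length := List.length_rotate L k
      rw [hullOf_congr hmem]
      simp only [hmem]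
      generalize L.rotate k = R at *
      match R, hk, hcR, hlen with
      | [p], _, _, hlen => simp at hlen; omega
      | p :: h :: M, hk, hcR, hlen =>
        rcases List.eq_nil_or_concat' M with rfl | ⟨N, e, rfl⟩
        · simp at hlen; omega
        simp only [List.map_cons, List.cons.injEq] at hk
        obtain ⟨rfl, rfl⟩ := hk
        have heven : Even (orientDet p h e) := by
          rw [even_orientDet_iff]
          simp at hd
          tauto
        have hear : ∀ T ∈ triangleList p h e,
            (∀ j, T.vertex j ∈ p :: h :: (N ++ [e])) ∧
              Even (orientDet (T.vertex 0) (T.vertex 1) (T.vertex 2)) := by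
          intro T hT
          rw [(mem_triangleList.1 hT).2]
          refine ⟨fun j => ?_, heven⟩
          fin_cases j <;> simp
        rcases eq_or_ne N [] with rfl | hN
        · refine ⟨triangleList p h e, ?_, hear⟩
          have := isTiling_triangleList hcR.ear_pos
          rwa [← hullOf_triple] at this
        · have hNlen : 0 < N.length := List.length_pos_iff.2 hN
          obtain ⟨ts, hts, hT⟩ := ih (h :: (N ++ [e])).length (by simp at hlen ⊢; omega) _ rfl
            (by simp; omega) (hcR.sublist (List.sublist_cons_self _ _)) ⟨x, hw'⟩
          refine ⟨triangleList p h e ++ ts, ?_, ?_⟩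
          · rw [hcR.hullOf_ear]
            exact (isTiling_triangleList hcR.ear_pos).append hts hcR.disjoint_ear
          · intro T hTm
            rcases List.mem_append.1 hTm with hTm | hTm
            · exact hear T hTm
            · exact ⟨fun j => List.mem_cons_of_mem _ ((hT T hTm).1 j), (hT T hTm).2⟩

/-! ### Polygons as lists of corners -/

namespace ConvexLatticePolygon

variable (P : ConvexLatticePolygon)

lemma region_eq_hullOf : P.region = hullOf P.vertexList := by
  rw [region, hullOf]
  congr 1
  ext x
  simp [vertexList, List.mem_ofFn]

lemma length_vertexList : P.vertexList.length = P.n := by simp [vertexList]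

lemma vertexList_ne_nil : P.vertexList ≠ [] := by
  rw [← List.length_pos_iff, P.length_vertexList]
  have := P.three_le
  omega

lemma isCCW_vertexList : IsCCW P.vertexList := by
  intro a b c h
  rw [List.sublist_iff_exists_fin_orderEmbedding_get_eq] at h
  obtain ⟨f, hf⟩ := h
  have h0 := hf 0
  have h1 := hf 1
  have h2 := hf 2
  simp only [vertexList, List.get_ofFn] at h0 h1 h2
  simp at h0 h1 h2
  rw [h0, h1, h2]
  apply P.counterclockwise
  · exact f.lt_iff_lt.2 (show (0 : Fin 3) < 1 by decide)
  · exact f.lt_iff_lt.2 (show (1 : Fin 3) < 2 by decide)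

lemma isDissection_get {ts : List LatticeTriangle} (h : IsTiling P.region ts) :
    P.IsDissection ts.get where
  union_eq := by
    ext x
    rw [h.mem_iff, Set.mem_iUnion]
    constructor
    · rintro ⟨i, hi⟩
      exact ⟨_, List.get_mem ts i, hi⟩
    · rintro ⟨T, hT, hx⟩
      obtain ⟨i, rfl⟩ := List.get_of_mem hT
      exact ⟨i, hx⟩
  disjoint_interior i j hij := by
    have := List.pairwise_iff_get.1 h.pairwise
    rcases hij.lt_or_gt with h1 | h1
    · exact this i j h1
    · exact (this j i h1).symm

variable {P}

lemma IsDissection.isTiling_ofFn {m : ℕ} {T : Fin m → LatticeTriangle} (h : P.IsDissection T) :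
    IsTiling P.region (List.ofFn T) where
  mem_iff x := by
    rw [← h.union_eq]
    simp [List.mem_ofFn]
  pairwise := by
    rw [List.pairwise_ofFn]
    exact fun i j hij => h.disjoint_interior i j hij.ne

theorem hasUnitAreaDissection_of_integral (h : P.HasIntegralDissection) :
    P.HasUnitAreaDissection := by
  obtain ⟨m, T, hT, hk⟩ := h
  obtain ⟨us, hus, hU⟩ := hT.isTiling_ofFn.refine (Q := fun U => U.area = 1) (by
    intro U hU
    obtain ⟨i, rfl⟩ := (List.mem_ofFn' _ _).1 hU
    exact (T i).exists_unit_tiling (hk i))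
  exact ⟨_, us.get, P.isDissection_get hus, fun i => hU _ (List.get_mem us i)⟩

theorem hasIntegralDiagonalDissection_of_contractible (h : Contractible P.boundaryWord) :
    P.HasIntegralDiagonalDissection := by
  obtain ⟨ts, hts, hT⟩ := exists_diagonal_tiling_of_contractible _ P.vertexList rfl
    (by rw [P.length_vertexList]; exact P.three_le) P.isCCW_vertexList h
  rw [← P.region_eq_hullOf] at hts
  refine ⟨_, ts.get, P.isDissection_get hts, fun i j => ?_, fun i => ?_⟩
  · have := (hT _ (List.get_mem ts i)).1 j
    exact (List.mem_ofFn' _ _).1 this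
  · exact (LatticeTriangle.isInt_area_iff _).2 (hT _ (List.get_mem ts i)).2

end ConvexLatticePolygon

/-! ### Barycentric coordinates and edges of a triangle -/

/-- The `i`-th barycentric coordinate of a point, up to the factor `det3`. -/
def bary (V : Fin 3 → ℤ × ℤ) (i : Fin 3) (x : ℝ × ℝ) : ℝ :=
  det3 (toPlane (V (i + 1))) (toPlane (V (i + 2))) x

/-- The point `x` lies on the edge opposite to the `i`-th vertex. -/
def OnEdge (V : Fin 3 → ℤ × ℤ) (i : Fin 3) (x : ℝ × ℝ) : Prop :=
  (∀ k, 0 ≤ bary V k x) ∧ bary V i x = 0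

section Bary

variable {V : Fin 3 → ℤ × ℤ}

lemma bary_combination (i : Fin 3) (x y : ℝ × ℝ) {s t : ℝ} (h : s + t = 1) :
    bary V i (s • x + t • y) = s * bary V i x + t * bary V i y :=
  det3_combination _ _ _ _ h

lemma continuous_bary (i : Fin 3) : Continuous (bary V i) := continuous_det3 _ _

lemma mem_tri_iff_bary (h : 0 < orientDet (V 0) (V 1) (V 2)) (x : ℝ × ℝ) :
    x ∈ tri (V 0) (V 1) (V 2) ↔ ∀ i, 0 ≤ bary V i x := by
  rw [mem_tri h]
  constructor
  · rintro ⟨h2, h0, h1⟩ i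
    fin_cases i
    exacts [h0, h1, h2]
  · exact fun h => ⟨h 2, h 0, h 1⟩

lemma sum_bary (x : ℝ × ℝ) : ∑ i, bary V i x = orientDet (V 0) (V 1) (V 2) := by
  rw [Fin.sum_univ_three, cast_orientDet, ← det3_add_det3_add_det3 _ _ _ x]
  rfl

lemma smul_eq_sum_bary (x : ℝ × ℝ) :
    (orientDet (V 0) (V 1) (V 2) : ℝ) • x = ∑ i, bary V i x • toPlane (V i) := by
  rw [Fin.sum_univ_three, cast_orientDet, det3_smul_eq]
  rfl

lemma bary_vertex_of_ne {i k : Fin 3} (h : i ≠ k) : bary V i (toPlane (V k)) = 0 := by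
  have : k = i + 1 ∨ k = i + 2 := by revert i k; decide
  rcases this with rfl | rfl
  · exact det3_self_left _ _
  · exact det3_self_right _ _

lemma bary_vertex_self (k : Fin 3) :
    bary V k (toPlane (V k)) = orientDet (V 0) (V 1) (V 2) := by
  rw [← sum_bary (toPlane (V k)), Finset.sum_eq_single k]
  · exact fun i _ h => bary_vertex_of_ne h
  · simp

lemma onEdge_vertex (h : 0 < orientDet (V 0) (V 1) (V 2)) {i k : Fin 3} (hik : i ≠ k) :
    OnEdge V i (toPlane (V k)) := by
  refine ⟨fun j => ?_, bary_vertex_of_ne hik⟩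
  by_cases hj : j = k
  · rw [hj, bary_vertex_self]
    exact_mod_cast h.le
  · exact (bary_vertex_of_ne hj).ge

lemma OnEdge.combination {i : Fin 3} {x y : ℝ × ℝ} (hx : OnEdge V i x) (hy : OnEdge V i y)
    {s t : ℝ} (hs : 0 ≤ s) (ht : 0 ≤ t) (hst : s + t = 1) : OnEdge V i (s • x + t • y) := by
  constructor
  · intro k
    rw [bary_combination k x y hst]
    have := hx.1 k
    have := hy.1 k
    positivity
  · rw [bary_combination i x y hst, hx.2, hy.2]
    ring

lemma vertex_ne_vertex (h : 0 < orientDet (V 0) (V 1) (V 2)) (i : Fin 3) :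
    V (i + 1) ≠ V (i + 2) := by
  intro he
  have h1 := onEdge_vertex h (i := i + 1) (k := i + 2) ((by decide : ∀ i : Fin 3, i + 1 ≠ i + 2) i)
  rw [← he] at h1
  have h2 := h1.2
  rw [bary_vertex_self] at h2
  have : (0 : ℝ) < orientDet (V 0) (V 1) (V 2) := by exact_mod_cast h
  linarith

/-- If the midpoint of two points of a triangle lies on an edge, then so do the points. -/
lemma onEdge_of_midpoint {x y : ℝ × ℝ} (hx : ∀ k, 0 ≤ bary V k x) (hy : ∀ k, 0 ≤ bary V k y)
    {i : Fin 3} (h : bary V i ((1 / 2 : ℝ) • x + (1 / 2 : ℝ) • y) = 0) :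
    OnEdge V i x ∧ OnEdge V i y := by
  rw [bary_combination i x y (by norm_num)] at h
  have h1 := hx i
  have h2 := hy i
  exact ⟨⟨hx, by linarith⟩, ⟨hy, by linarith⟩⟩

lemma isOpen_bary_pos : IsOpen {x | ∀ i, 0 < bary V i x} := by
  have : {x | ∀ i, 0 < bary V i x} = ⋂ i, {x | 0 < bary V i x} := by ext; simp
  rw [this]
  exact isOpen_iInter_of_finite fun i => isOpen_lt continuous_const (continuous_bary i)

lemma bary_pos_subset_interior (h : 0 < orientDet (V 0) (V 1) (V 2)) :
    {x | ∀ i, 0 < bary V i x} ⊆ interior (tri (V 0) (V 1) (V 2)) :=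
  interior_maximal (fun x hx => (mem_tri_iff_bary h x).2 fun i => (hx i).le) isOpen_bary_pos

lemma exists_bary_pos (h : 0 < orientDet (V 0) (V 1) (V 2)) : ∃ c, ∀ i, 0 < bary V i c := by
  have h' : (0 : ℝ) < orientDet (V 0) (V 1) (V 2) := by exact_mod_cast h
  refine ⟨(1 / 2 : ℝ) • toPlane (V 0) +
    (1 / 2 : ℝ) • ((1 / 2 : ℝ) • toPlane (V 1) + (1 / 2 : ℝ) • toPlane (V 2)), fun i => ?_⟩
  rw [bary_combination _ _ _ (by norm_num), bary_combination _ _ _ (by norm_num)]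
  have h3 : ∀ k, 0 ≤ bary V i (toPlane (V k)) := fun k => by
    by_cases hk : i = k
    · rw [hk, bary_vertex_self]; exact h'.le
    · exact (bary_vertex_of_ne hk).ge
  have h4 : 0 < bary V i (toPlane (V i)) := by rw [bary_vertex_self]; exact h'
  have h5 := h3 0
  have h6 := h3 1
  have h7 := h3 2
  have h8 : i = 0 ∨ i = 1 ∨ i = 2 :=
    (by decide : ∀ i : Fin 3, i = 0 ∨ i = 1 ∨ i = 2) i
  rcases h8 with rfl | rfl | rfl <;> linarith

/-- A common point of two triangles with disjoint interiors lies on the boundary of both. -/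
lemma exists_bary_eq_zero {V' : Fin 3 → ℤ × ℤ} (h : 0 < orientDet (V 0) (V 1) (V 2))
    (h' : 0 < orientDet (V' 0) (V' 1) (V' 2))
    (hd : Disjoint (interior (tri (V 0) (V 1) (V 2))) (interior (tri (V' 0) (V' 1) (V' 2))))
    {x : ℝ × ℝ} (hx : ∀ k, 0 ≤ bary V k x) (hx' : ∀ k, 0 ≤ bary V' k x) :
    ∃ i, bary V i x = 0 := by
  by_contra! h0
  have hpos : x ∈ {x | ∀ i, 0 < bary V i x} := fun i => lt_of_le_of_ne (hx i) (h0 i).symm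
  obtain ⟨c, hc⟩ := exists_bary_pos h'
  obtain ⟨ε, hε, hε1, hmem⟩ := exists_pos_smul_mem isOpen_bary_pos hpos (c - x)
  refine Set.disjoint_left.1 hd (bary_pos_subset_interior h hmem)
    (bary_pos_subset_interior h' fun i => ?_)
  have h1 : x + ε • (c - x) = (1 - ε) • x + ε • c := by module
  rw [h1, bary_combination i x c (by ring)]
  have := hx' i
  have := mul_pos hε (hc i)
  have : 0 ≤ (1 - ε) * bary V' i x := mul_nonneg (by linarith) (hx' i)
  linarith

end Bary

/-! ### Heights of lattice points -/

/-- The linear function in whose order the vertices of a dissection are visited. It takes different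
values at different lattice points. -/
noncomputable def height (x : ℝ × ℝ) : ℝ := x.1 + √2 * x.2

lemma height_combination (s t : ℝ) (x y : ℝ × ℝ) :
    height (s • x + t • y) = s * height x + t * height y := by
  simp only [height, Prod.fst_add, Prod.snd_add, Prod.smul_fst, Prod.smul_snd, smul_eq_mul]
  ring

lemma eq_of_height_eq {p q : ℤ × ℤ} (h : height (toPlane p) = height (toPlane q)) : p = q := by
  simp only [height, toPlane] at h
  have h2 : p.2 = q.2 := by
    by_contra hne
    have hne' : (p.2 : ℝ) - q.2 ≠ 0 := sub_ne_zero.2 (by exact_mod_cast hne)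
    refine irrational_sqrt_two ⟨((q.1 - p.1 : ℤ) : ℚ) / ((p.2 - q.2 : ℤ) : ℚ), ?_⟩
    push_cast
    rw [div_eq_iff hne']
    linarith
  refine Prod.ext ?_ h2
  rw [h2] at h
  have : (p.1 : ℝ) = q.1 := by linarith
  exact_mod_cast this

/-- The points of a line are determined by their heights. -/
lemma eq_of_mem_line {a b v x y : ℝ × ℝ} (hab : a ≠ b) (hv : det3 a b v = 0)
    (hx : det3 a b x = 0) (hy : det3 a b y = 0) (hh : height x ≠ height v) :
    y = v + ((height y - height v) / (height x - height v)) • (x - v) := by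
  have hne : height x - height v ≠ 0 := sub_ne_zero.2 hh
  have hcross : (y.1 - v.1) * (x.2 - v.2) = (y.2 - v.2) * (x.1 - v.1) := by
    simp only [det3] at hv hx hy
    by_cases h1 : b.1 - a.1 = 0
    · have h2 : b.2 - a.2 ≠ 0 := fun h2 => hab (Prod.ext (by linarith) (by linarith))
      apply mul_left_cancel₀ h2
      linear_combination (y.2 - v.2) * (hx - hv) - (x.2 - v.2) * (hy - hv)
    · apply mul_left_cancel₀ h1
      linear_combination (y.1 - v.1) * (hx - hv) - (x.1 - v.1) * (hy - hv)
  have key : ∀ c d : ℝ, (height x - height v) * c = (height y - height v) * d →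
      c = (height y - height v) / (height x - height v) * d := by
    intro c d h
    field_simp
    linarith
  have e1 := key (y.1 - v.1) (x.1 - v.1) (by simp only [height]; linear_combination √2 * hcross)
  have e2 := key (y.2 - v.2) (x.2 - v.2) (by simp only [height]; linear_combination -hcross)
  ext
  · simp only [Prod.fst_add, Prod.smul_fst, Prod.fst_sub, smul_eq_mul]; linarith
  · simp only [Prod.snd_add, Prod.smul_snd, Prod.snd_sub, smul_eq_mul]; linarith

section Height

variable {V : Fin 3 → ℤ × ℤ}

lemma mul_height_eq (x : ℝ × ℝ) : (orientDet (V 0) (V 1) (V 2) : ℝ) * height x =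
    ∑ i, bary V i x * height (toPlane (V i)) := by
  have h := smul_eq_sum_bary (V := V) x
  rw [Fin.sum_univ_three] at h ⊢
  have h1 := congrArg Prod.fst h
  have h2 := congrArg Prod.snd h
  simp only [Prod.fst_add, Prod.snd_add, Prod.smul_fst, Prod.smul_snd, smul_eq_mul] at h1 h2
  simp only [height]
  linear_combination h1 + √2 * h2

lemma exists_height_vertex_le (h : 0 < orientDet (V 0) (V 1) (V 2)) {x : ℝ × ℝ}
    (hx : ∀ k, 0 ≤ bary V k x) : ∃ k, bary V k x ≠ 0 ∧ height (toPlane (V k)) ≤ height x := by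
  by_contra! hcon
  have h' : (0 : ℝ) < orientDet (V 0) (V 1) (V 2) := by exact_mod_cast h
  have h1 := mul_height_eq (V := V) x
  have h2 := sum_bary (V := V) x
  obtain ⟨k, -, hk⟩ := Finset.exists_ne_zero_of_sum_ne_zero (h2.trans_ne h'.ne')
  have h3 : ∑ i, bary V i x * height x < ∑ i, bary V i x * height (toPlane (V i)) := by
    refine Finset.sum_lt_sum (fun i _ => ?_) ⟨k, Finset.mem_univ k, ?_⟩
    · by_cases hi : bary V i x = 0
      · simp [hi]
      · exact mul_le_mul_of_nonneg_left (hcon i hi).le (hx i)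
    · exact mul_lt_mul_of_pos_left (hcon k hk) (lt_of_le_of_ne (hx k) hk.symm)
  rw [← Finset.sum_mul, h2, ← h1] at h3
  exact lt_irrefl _ h3

lemma exists_height_vertex_ge (h : 0 < orientDet (V 0) (V 1) (V 2)) {x : ℝ × ℝ}
    (hx : ∀ k, 0 ≤ bary V k x) : ∃ k, bary V k x ≠ 0 ∧ height x ≤ height (toPlane (V k)) := by
  by_contra! hcon
  have h' : (0 : ℝ) < orientDet (V 0) (V 1) (V 2) := by exact_mod_cast h
  have h1 := mul_height_eq (V := V) x
  have h2 := sum_bary (V := V) x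
  obtain ⟨k, -, hk⟩ := Finset.exists_ne_zero_of_sum_ne_zero (h2.trans_ne h'.ne')
  have h3 : ∑ i, bary V i x * height (toPlane (V i)) < ∑ i, bary V i x * height x := by
    refine Finset.sum_lt_sum (fun i _ => ?_) ⟨k, Finset.mem_univ k, ?_⟩
    · by_cases hi : bary V i x = 0
      · simp [hi]
      · exact mul_le_mul_of_nonneg_left (hcon i hi).le (hx i)
    · exact mul_lt_mul_of_pos_left (hcon k hk) (lt_of_le_of_ne (hx k) hk.symm)
  rw [← Finset.sum_mul, h2, ← h1] at h3
  exact lt_irrefl _ h3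

/-- The lattice point `v` lies on an edge of the triangle with the `j`-th vertex as an endpoint, and
above this vertex. -/
def LiesAbove (V : Fin 3 → ℤ × ℤ) (j : Fin 3) (v : ℤ × ℤ) : Prop :=
  (∃ i, i ≠ j ∧ OnEdge V i (toPlane v)) ∧ height (toPlane (V j)) < height (toPlane v)

lemma exists_liesAbove_of_onEdge (h : 0 < orientDet (V 0) (V 1) (V 2)) {v : ℤ × ℤ} {x : ℝ × ℝ}
    {i : Fin 3} (hv : OnEdge V i (toPlane v)) (hx : OnEdge V i x)
    (hxv : height x < height (toPlane v)) : ∃ j, i ≠ j ∧ LiesAbove V j v := by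
  obtain ⟨j, hj, hle⟩ := exists_height_vertex_le h hx.1
  have hij : i ≠ j := by rintro rfl; exact hj hx.2
  exact ⟨j, hij, ⟨i, hij, hv⟩, hle.trans_lt hxv⟩

lemma exists_liesAbove_of_mem (h : 0 < orientDet (V 0) (V 1) (V 2)) {v : ℤ × ℤ} {x : ℝ × ℝ}
    {i : Fin 3} (hv : OnEdge V i (toPlane v)) (hx : ∀ k, 0 ≤ bary V k x)
    (hxv : height x < height (toPlane v)) : ∃ j, LiesAbove V j v := by
  obtain ⟨j, -, hle⟩ := exists_height_vertex_le h hx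
  have hj := hle.trans_lt hxv
  by_cases hij : i = j
  · obtain ⟨k, hk, hle⟩ := exists_height_vertex_le h hv.1
    have hik : i ≠ k := by rintro rfl; exact hk hv.2
    rcases hle.lt_or_eq with hlt | heq
    · exact ⟨k, ⟨i, hik, hv⟩, hlt⟩
    · -- here `v` is the vertex `V k`, and lies on the edge from `V j` to `V k`
      obtain ⟨l, hlj, hlk⟩ : ∃ l, l ≠ j ∧ l ≠ k :=
        (by decide : ∀ j k : Fin 3, ∃ l, l ≠ j ∧ l ≠ k) j k
      refine ⟨j, ⟨l, hlj, ?_⟩, hj⟩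
      rw [← eq_of_height_eq heq]
      exact onEdge_vertex h hlk
  · exact ⟨j, ⟨i, hij, hv⟩, hj⟩

/-- A lattice point that lies above two vertices of a triangle is the third vertex. -/
lemma LiesAbove.eq_vertex (h : 0 < orientDet (V 0) (V 1) (V 2)) {v : ℤ × ℤ} {j j' : Fin 3}
    (hj : LiesAbove V j v) (hj' : LiesAbove V j' v) (hne : j ≠ j') :
    ∃ l, l ≠ j ∧ l ≠ j' ∧ v = V l := by
  obtain ⟨⟨i, hij, hi⟩, hlt⟩ := hj
  obtain ⟨⟨i', hij', hi'⟩, hlt'⟩ := hj'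
  obtain ⟨l, hl, hle⟩ := exists_height_vertex_ge h hi.1
  have hlj : l ≠ j := by rintro rfl; exact absurd hle hlt.not_ge
  have hlj' : l ≠ j' := by rintro rfl; exact absurd hle hlt'.not_ge
  have hli : l ≠ i := by rintro rfl; exact hl hi.2
  have hli' : l ≠ i' := by rintro rfl; exact hl hi'.2
  refine ⟨l, hlj, hlj', toPlane_injective ?_⟩
  have hzero : ∀ m, m ≠ l → bary V m (toPlane v) = 0 := by
    intro m hm
    have : m = i ∨ m = i' := by
      clear hi hi' hl hle hlt hlt'
      revert i i' j j' l m
      decide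
    rcases this with rfl | rfl
    exacts [hi.2, hi'.2]
  have h1 := smul_eq_sum_bary (V := V) (toPlane v)
  have h2 := sum_bary (V := V) (toPlane v)
  rw [Finset.sum_eq_single l (fun m _ hm => by rw [hzero m hm, zero_smul]) (by simp)] at h1
  rw [Finset.sum_eq_single l (fun m _ hm => hzero m hm) (by simp)] at h2
  rw [h2] at h1
  have h' : (orientDet (V 0) (V 1) (V 2) : ℝ) ≠ 0 := by exact_mod_cast h.ne'
  exact smul_right_injective _ h' h1

end Height

/-! ### Labelling the vertices of a dissection -/

section Sweep

/-- The step between the colours of two lattice points. -/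
def colorStep (p q : ℤ × ℤ) : FreeGroup (Color × Color) :=
  transition (parityColor p) (parityColor q)

@[simp] lemma colorStep_self (p : ℤ × ℤ) : colorStep p p = 1 := transition_self _

@[simp] lemma colorStep_mul_swap (p q : ℤ × ℤ) : colorStep p q * colorStep q p = 1 :=
  transition_mul_swap _ _

lemma colorStep_mul_colorStep {p q r : ℤ × ℤ} (h : Even (orientDet p q r)) :
    colorStep p q * colorStep q r = colorStep p r :=
  transition_mul_transition ((even_orientDet_iff p q r).1 h)

/-- The colours of lattice points on a line form a word without essential steps: at most two colours
occur among three such points. -/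
lemma colorStep_mul_colorStep_of_det3 {p q r : ℤ × ℤ}
    (h : det3 (toPlane p) (toPlane q) (toPlane r) = 0) :
    colorStep p q * colorStep q r = colorStep p r := by
  apply colorStep_mul_colorStep
  rw [← cast_orientDet] at h
  have : orientDet p q r = 0 := by exact_mod_cast h
  simp [this]

variable {m : ℕ} {V : Fin m → Fin 3 → ℤ × ℤ}

/-- The labels `s` of the points in `W` differ by the steps between their colours along the edges of
the triangles. -/
def IsFlatOn (V : Fin m → Fin 3 → ℤ × ℤ) (W : Finset (ℤ × ℤ))
    (s : ℤ × ℤ → FreeGroup (Color × Color)) : Prop :=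
  ∀ t j v, v ∈ W → V t j ∈ W → LiesAbove (V t) j v → s v = s (V t j) * colorStep (V t j) v

variable {W : Finset (ℤ × ℤ)} {s : ℤ × ℤ → FreeGroup (Color × Color)} {v : ℤ × ℤ}

lemma colorStep_vertex {V : Fin 3 → ℤ × ℤ} (he : Even (orientDet (V 0) (V 1) (V 2)))
    (a b c : Fin 3) : colorStep (V a) (V b) * colorStep (V b) (V c) = colorStep (V a) (V c) := by
  rw [even_orientDet_iff] at he
  refine transition_mul_transition ?_
  fin_cases a <;> fin_cases b <;> fin_cases c <;> simp at he ⊢ <;> tauto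

lemma det3_eq_zero_of_mem_line {a b x y z : ℝ × ℝ} (hab : a ≠ b) (hx : det3 a b x = 0)
    (hy : det3 a b y = 0) (hz : det3 a b z = 0) : det3 x y z = 0 := by
  simp only [det3] at *
  by_cases h1 : b.1 - a.1 = 0
  · have h2 : b.2 - a.2 ≠ 0 := fun h2 => hab (Prod.ext (by linarith) (by linarith))
    apply mul_left_cancel₀ h2
    linear_combination (z.2 - x.2) * (-(hy - hx)) + (y.2 - x.2) * (hz - hx)
  · apply mul_left_cancel₀ h1
    linear_combination (y.1 - x.1) * (hz - hx) - (z.1 - x.1) * (hy - hx)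

/-- Two triangles with edges through `v` and a lower point `x` give the same label to `v`. -/
lemma label_eq_of_common_edge (hpos : ∀ t, 0 < orientDet (V t 0) (V t 1) (V t 2))
    (hs : IsFlatOn V W s)
    (hW : ∀ t j, height (toPlane (V t j)) < height (toPlane v) → V t j ∈ W)
    {t t' : Fin m} {i i' j j' : Fin 3} {x : ℝ × ℝ} (hx : height x < height (toPlane v))
    (hi : OnEdge (V t) i (toPlane v)) (hxi : OnEdge (V t) i x) (hij : i ≠ j)
    (hi' : OnEdge (V t') i' (toPlane v)) (hxi' : OnEdge (V t') i' x) (hij' : i' ≠ j')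
    (hj : height (toPlane (V t j)) < height (toPlane v))
    (hj' : height (toPlane (V t' j')) < height (toPlane v)) :
    s (V t j) * colorStep (V t j) v = s (V t' j') * colorStep (V t' j') v := by
  have hne : ∀ t i, toPlane (V t (i + 1)) ≠ toPlane (V t (i + 2)) := fun t i h =>
    vertex_ne_vertex (hpos t) i (toPlane_injective h)
  have hp := eq_of_mem_line (hne t i) hi.2 hxi.2 (onEdge_vertex (hpos t) hij).2 hx.ne
  have hp' := eq_of_mem_line (hne t' i') hi'.2 hxi'.2 (onEdge_vertex (hpos t') hij').2 hx.ne
  wlog hle : height (toPlane (V t j)) ≤ height (toPlane (V t' j')) generalizing t t' i i' j j'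
  · exact (this hi' hxi' hij' hi hxi hij hj' hj hp' hp (le_of_not_ge hle)).symm
  rcases hle.lt_or_eq with hlt | heq
  · set p := toPlane (V t j) with hpdef
    set p' := toPlane (V t' j') with hpdef'
    set q := toPlane v
    have hd : 0 < height q - height p := by linarith
    have hd' : height x - height q ≠ 0 := by linarith
    -- the higher of the two vertices lies between the lower one and `v`
    have hcomb : p' = ((height q - height p') / (height q - height p)) • p +
        ((height p' - height p) / (height q - height p)) • q := by
      have hAB : ∀ A B α α' : ℝ, A + B = 1 → A * α = α' →
          q + α' • (x - q) = A • (q + α • (x - q)) + B • q := by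
        rintro A B α _ h rfl
        obtain rfl : B = 1 - A := by linarith
        module
      have h2 := hAB ((height q - height p') / (height q - height p))
        ((height p' - height p) / (height q - height p))
        ((height p - height q) / (height x - height q))
        ((height p' - height q) / (height x - height q))
        (by rw [← add_div]; exact (div_eq_one_iff_eq hd.ne').2 (by ring))
        (by field_simp; ring)
      rwa [← hp, ← hp'] at h2
    have honEdge : OnEdge (V t) i p' := by
      rw [hcomb]
      refine (onEdge_vertex (hpos t) hij).combination hi (div_nonneg (by linarith) hd.le)
        (div_nonneg (by linarith) hd.le) ?_
      rw [← add_div]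
      exact (div_eq_one_iff_eq hd.ne').2 (by ring)
    have h1 := hs t j (V t' j') (hW t' j' hj') (hW t j hj) ⟨⟨i, hij, honEdge⟩, hlt⟩
    rw [h1, mul_assoc, colorStep_mul_colorStep_of_det3]
    exact det3_eq_zero_of_mem_line (hne t i) (onEdge_vertex (hpos t) hij).2 honEdge.2 hi.2
  · rw [eq_of_height_eq heq]

/-- The two edges of a triangle that arrive at `v` from below give the same label to `v`. -/
lemma label_eq_of_same_triangle (hpos : ∀ t, 0 < orientDet (V t 0) (V t 1) (V t 2))
    (heven : ∀ t, Even (orientDet (V t 0) (V t 1) (V t 2)))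
    (hs : IsFlatOn V W s)
    (hW : ∀ t j, height (toPlane (V t j)) < height (toPlane v) → V t j ∈ W)
    {t : Fin m} {j j' : Fin 3} (hj : LiesAbove (V t) j v) (hj' : LiesAbove (V t) j' v) :
    s (V t j) * colorStep (V t j) v = s (V t j') * colorStep (V t j') v := by
  by_cases hne : j = j'
  · rw [hne]
  wlog hle : height (toPlane (V t j)) ≤ height (toPlane (V t j')) generalizing j j'
  · exact (this hj' hj (Ne.symm hne) (le_of_not_ge hle)).symm
  rcases hle.lt_or_eq with hlt | heq
  · obtain ⟨l, hlj, hlj', rfl⟩ := hj.eq_vertex (hpos t) hj' hne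
    have h1 := hs t j (V t j') (hW t j' hj'.2) (hW t j hj.2)
      ⟨⟨l, hlj, onEdge_vertex (hpos t) hlj'⟩, hlt⟩
    rw [h1, mul_assoc, colorStep_vertex (heven t)]
  · rw [eq_of_height_eq heq]

/-- Two triangles that share `v` and a lower point `x` give the same label to `v`. -/
lemma label_eq_of_common_point (hpos : ∀ t, 0 < orientDet (V t 0) (V t 1) (V t 2))
    (heven : ∀ t, Even (orientDet (V t 0) (V t 1) (V t 2)))
    (hdisj : ∀ t t', t ≠ t' → Disjoint (interior (tri (V t 0) (V t 1) (V t 2)))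
      (interior (tri (V t' 0) (V t' 1) (V t' 2))))
    (hs : IsFlatOn V W s)
    (hW : ∀ t j, height (toPlane (V t j)) < height (toPlane v) → V t j ∈ W)
    {t t' : Fin m} {j j' : Fin 3} {x : ℝ × ℝ} (hx : height x < height (toPlane v))
    (hxt : ∀ k, 0 ≤ bary (V t) k x) (hxt' : ∀ k, 0 ≤ bary (V t') k x)
    (hj : LiesAbove (V t) j v) (hj' : LiesAbove (V t') j' v) :
    s (V t j) * colorStep (V t j) v = s (V t' j') * colorStep (V t' j') v := by
  by_cases htt : t = t'
  · subst htt
    exact label_eq_of_same_triangle hpos heven hs hW hj hj'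
  obtain ⟨⟨i₀, -, hv⟩, -⟩ := id hj
  obtain ⟨⟨i₀', -, hv'⟩, -⟩ := id hj'
  -- the midpoint of `v` and `x` is a boundary point of both triangles
  have hmid : ∀ t, (∀ k, 0 ≤ bary (V t) k (toPlane v)) → (∀ k, 0 ≤ bary (V t) k x) →
      ∀ k, 0 ≤ bary (V t) k ((1 / 2 : ℝ) • toPlane v + (1 / 2 : ℝ) • x) := by
    intro t h1 h2 k
    rw [bary_combination _ _ _ (by norm_num)]
    have := h1 k
    have := h2 k
    positivity
  have m1 := hmid t hv.1 hxt
  have m2 := hmid t' hv'.1 hxt'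
  obtain ⟨i, hi⟩ := exists_bary_eq_zero (hpos t) (hpos t') (hdisj t t' htt) m1 m2
  obtain ⟨i', hi'⟩ := exists_bary_eq_zero (hpos t') (hpos t) (hdisj t' t (Ne.symm htt)) m2 m1
  obtain ⟨e1, e2⟩ := onEdge_of_midpoint hv.1 hxt hi
  obtain ⟨e1', e2'⟩ := onEdge_of_midpoint hv'.1 hxt' hi'
  obtain ⟨k, hik, hk⟩ := exists_liesAbove_of_onEdge (hpos t) e1 e2 hx
  obtain ⟨k', hik', hk'⟩ := exists_liesAbove_of_onEdge (hpos t') e1' e2' hx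
  rw [label_eq_of_same_triangle hpos heven hs hW hj hk,
    label_eq_of_same_triangle hpos heven hs hW hj' hk']
  exact label_eq_of_common_edge hpos hs hW hx e1 e2 hik e1' e2' hik' hk.2 hk'.2

/-- Close to `v` there are only triangles that contain `v`. -/
lemma exists_ball_mem_triangle (V : Fin m → Fin 3 → ℤ × ℤ) (v : ℝ × ℝ) :
    ∃ δ > 0, ∀ x ∈ Metric.ball v δ, ∀ t, (∀ k, 0 ≤ bary (V t) k x) → ∀ k, 0 ≤ bary (V t) k v := by
  have hopen : IsOpen
      (⋂ t : {t // ¬ ∀ k, 0 ≤ bary (V t) k v}, {x | ¬ ∀ k, 0 ≤ bary (V t) k x}) := by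
    refine isOpen_iInter_of_finite fun t => ?_
    have : {x | ¬ ∀ k, 0 ≤ bary (V t) k x} = ⋃ k, {x | bary (V t) k x < 0} := by ext; simp
    rw [this]
    exact isOpen_iUnion fun k => isOpen_lt (continuous_bary k) continuous_const
  obtain ⟨δ, hδ, hball⟩ := Metric.isOpen_iff.1 hopen v (Set.mem_iInter.2 fun t => t.2)
  refine ⟨δ, hδ, fun x hx t hxt => ?_⟩
  by_contra hv
  exact Set.mem_iInter.1 (hball hx) ⟨t, hv⟩ hxt

/-- All edges that arrive at `v` from below give the same label to `v`: any two of them are joined by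
a short segment close to `v`, and the triangles which this segment meets contain `v`. Neighbouring
ones give the same label, and a segment is connected. -/
lemma label_eq (hpos : ∀ t, 0 < orientDet (V t 0) (V t 1) (V t 2))
    (heven : ∀ t, Even (orientDet (V t 0) (V t 1) (V t 2)))
    (hdisj : ∀ t t', t ≠ t' → Disjoint (interior (tri (V t 0) (V t 1) (V t 2)))
      (interior (tri (V t' 0) (V t' 1) (V t' 2))))
    {S : Set (ℝ × ℝ)} (hS : Convex ℝ S) (hcov : ∀ x, x ∈ S ↔ ∃ t, ∀ k, 0 ≤ bary (V t) k x)
    (hs : IsFlatOn V W s)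
    (hW : ∀ t j, height (toPlane (V t j)) < height (toPlane v) → V t j ∈ W)
    {t t' : Fin m} {j j' : Fin 3} (hj : LiesAbove (V t) j v) (hj' : LiesAbove (V t') j' v) :
    s (V t j) * colorStep (V t j) v = s (V t' j') * colorStep (V t' j') v := by
  obtain ⟨δ, hδ, hball⟩ := exists_ball_mem_triangle V (toPlane v)
  -- a point close to `v` on the edge from `V t j`
  have hnear : ∀ t j, LiesAbove (V t) j v → ∃ x ∈ Metric.ball (toPlane v) δ,
      height x < height (toPlane v) ∧ ∀ k, 0 ≤ bary (V t) k x := by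
    rintro t j ⟨⟨i, hij, hi⟩, hlt⟩
    obtain ⟨ε, hε, hε1, hmem⟩ := exists_pos_smul_mem Metric.isOpen_ball
      (Metric.mem_ball_self hδ) (toPlane (V t j) - toPlane v)
    have h1 : toPlane v + ε • (toPlane (V t j) - toPlane v) =
        (1 - ε) • toPlane v + ε • toPlane (V t j) := by module
    rw [h1] at hmem
    refine ⟨_, hmem, ?_, (hi.combination (onEdge_vertex (hpos t) hij) (by linarith) hε.le
      (by ring)).1⟩
    rw [height_combination]
    nlinarith
  obtain ⟨p, hpb, hph, hpt⟩ := hnear t j hj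
  obtain ⟨q, hqb, hqh, hqt⟩ := hnear t' j' hj'
  set y : ℝ → ℝ × ℝ := fun r => (1 - r) • p + r • q with hy
  have hyc : Continuous y := by fun_prop
  have hyh : ∀ r ∈ Set.Icc (0 : ℝ) 1, height (y r) < height (toPlane v) := by
    rintro r ⟨h0, h1⟩
    simp only [hy]
    rw [height_combination]
    rcases h0.eq_or_lt with rfl | h0
    · simpa using hph
    · nlinarith
  have hclosed : ∀ t, IsClosed {r | ∀ k, 0 ≤ bary (V t) k (y r)} := by
    intro t
    have : {r | ∀ k, 0 ≤ bary (V t) k (y r)} = ⋂ k, {r | 0 ≤ bary (V t) k (y r)} := by ext; simp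
    rw [this]
    exact isClosed_iInter fun k => isClosed_le continuous_const ((continuous_bary k).comp hyc)
  by_contra hne
  set g := s (V t j) * colorStep (V t j) v with hg
  set A : Set (Fin m × Fin 3) :=
    {a | LiesAbove (V a.1) a.2 v ∧ s (V a.1 a.2) * colorStep (V a.1 a.2) v = g} with hA
  set B : Set (Fin m × Fin 3) :=
    {a | LiesAbove (V a.1) a.2 v ∧ s (V a.1 a.2) * colorStep (V a.1 a.2) v ≠ g} with hB
  set FA := ⋃ a ∈ A, {r | ∀ k, 0 ≤ bary (V a.1) k (y r)} with hFA
  set FB := ⋃ a ∈ B, {r | ∀ k, 0 ≤ bary (V a.1) k (y r)} with hFB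
  have hcover : Set.Icc (0 : ℝ) 1 ⊆ FA ∪ FB := by
    intro r hr
    have hyS : y r ∈ S := hS ((hcov p).2 ⟨t, hpt⟩) ((hcov q).2 ⟨t', hqt⟩) (by linarith [hr.2]) hr.1
      (by ring)
    obtain ⟨a, ha⟩ := (hcov _).1 hyS
    have hyb : y r ∈ Metric.ball (toPlane v) δ :=
      convex_ball _ _ hpb hqb (by linarith [hr.2]) hr.1 (by ring)
    have hva := hball _ hyb a ha
    -- `v` is not an inner point of a triangle, as it lies on an edge of `V t`
    obtain ⟨i, hi⟩ : ∃ i, OnEdge (V a) i (toPlane v) := by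
      obtain ⟨⟨i, -, hi⟩, -⟩ := id hj
      by_cases hat : a = t
      · exact ⟨i, hat ▸ hi⟩
      · obtain ⟨i', hi'⟩ := exists_bary_eq_zero (hpos a) (hpos t) (hdisj a t hat) hva hi.1
        exact ⟨i', hva, hi'⟩
    obtain ⟨k, hk⟩ := exists_liesAbove_of_mem (hpos a) hi ha (hyh r hr)
    by_cases hgk : s (V a k) * colorStep (V a k) v = g
    · exact Or.inl (Set.mem_iUnion₂.2 ⟨(a, k), ⟨hk, hgk⟩, ha⟩)
    · exact Or.inr (Set.mem_iUnion₂.2 ⟨(a, k), ⟨hk, hgk⟩, ha⟩)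
  have h0 : (0 : ℝ) ∈ FA := by
    refine Set.mem_iUnion₂.2 ⟨(t, j), ⟨hj, rfl⟩, ?_⟩
    simpa [hy] using hpt
  have h1 : (1 : ℝ) ∈ FB := by
    refine Set.mem_iUnion₂.2 ⟨(t', j'), ⟨hj', Ne.symm hne⟩, ?_⟩
    simpa [hy] using hqt
  obtain ⟨r, hr, hrA, hrB⟩ := isPreconnected_closed_iff.1
    (isPreconnected_Icc (a := (0 : ℝ)) (b := 1)) FA FB
    (A.toFinite.isClosed_biUnion fun a _ => hclosed a.1)
    (B.toFinite.isClosed_biUnion fun a _ => hclosed a.1)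
    hcover ⟨0, by simp, h0⟩ ⟨1, by simp, h1⟩
  obtain ⟨a, ha, hra⟩ := Set.mem_iUnion₂.1 hrA
  obtain ⟨b, hb, hrb⟩ := Set.mem_iUnion₂.1 hrB
  exact hb.2 ((label_eq_of_common_point hpos heven hdisj hs hW (hyh r hr) hrb hra hb.1 ha.1).trans
    ha.2)

/-- A dissection of a convex set into triangles of integer area has a labelling of its vertices which
is flat along all edges. The vertices are labelled in the order of increasing height. -/
lemma exists_isFlatOn (hpos : ∀ t, 0 < orientDet (V t 0) (V t 1) (V t 2))
    (heven : ∀ t, Even (orientDet (V t 0) (V t 1) (V t 2)))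
    (hdisj : ∀ t t', t ≠ t' → Disjoint (interior (tri (V t 0) (V t 1) (V t 2)))
      (interior (tri (V t' 0) (V t' 1) (V t' 2))))
    {S : Set (ℝ × ℝ)} (hS : Convex ℝ S) (hcov : ∀ x, x ∈ S ↔ ∃ t, ∀ k, 0 ≤ bary (V t) k x)
    {A : Finset (ℤ × ℤ)} (hA : ∀ t j, V t j ∈ A) : ∃ s, IsFlatOn V A s := by
  have key : ∀ W : Finset (ℤ × ℤ), (∀ p ∈ A, ∀ q ∈ W, height (toPlane p) < height (toPlane q) →
      p ∈ W) → ∃ s, IsFlatOn V W s := by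
    intro W
    induction W using Finset.induction_on_max_value (fun p => height (toPlane p)) with
    | empty => exact fun _ => ⟨1, fun t j v hv => absurd hv (Finset.notMem_empty v)⟩
    | insert a W ha hmax ih =>
      intro hlow
      have hlow' : ∀ p ∈ A, ∀ q, height (toPlane q) ≤ height (toPlane a) → q ∈ insert a W →
          height (toPlane p) < height (toPlane q) → p ∈ W := by
        intro p hp q hqa hq hpq
        refine (Finset.mem_insert.1 (hlow p hp q hq hpq)).resolve_left ?_
        rintro rfl
        linarith
      obtain ⟨s, hs⟩ := ih fun p hp q hq => hlow' p hp q (hmax q hq) (Finset.mem_insert_of_mem hq)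
      have hW : ∀ t j, height (toPlane (V t j)) < height (toPlane a) → V t j ∈ W :=
        fun t j => hlow' _ (hA t j) a le_rfl (Finset.mem_insert_self a W)
      have hold : ∀ g, ∀ v ∈ W, Function.update s a g v = s v := fun g v hv =>
        Function.update_of_ne (by rintro rfl; exact ha hv) _ _
      obtain ⟨g, hg⟩ : ∃ g, ∀ t j, LiesAbove (V t) j a → g = s (V t j) * colorStep (V t j) a := by
        by_cases h : ∃ t j, LiesAbove (V t) j a
        · obtain ⟨t, j, h⟩ := h
          exact ⟨_, fun t' j' h' => label_eq hpos heven hdisj hS hcov hs hW h h'⟩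
        · exact ⟨1, fun t j h' => absurd ⟨t, j, h'⟩ h⟩
      refine ⟨Function.update s a g, fun t j v hv hvt hl => ?_⟩
      have hva : height (toPlane v) ≤ height (toPlane a) := by
        rcases Finset.mem_insert.1 hv with rfl | hv
        exacts [le_rfl, hmax v hv]
      rw [hold g _ (hlow' _ (hA t j) v hva hv hl.2)]
      rcases Finset.mem_insert.1 hv with rfl | hvW
      · rw [Function.update_self]
        exact hg t j hl
      · rw [hold g v hvW]
        exact hs t j v hvW (hlow' _ (hA t j) v hva hv hl.2) hl
  exact key A fun p hp _ _ _ => hp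

/-- A flat labelling is also flat along the sides of the dissected set. -/
lemma IsFlatOn.eq_of_side (hpos : ∀ t, 0 < orientDet (V t 0) (V t 1) (V t 2))
    {S : Set (ℝ × ℝ)} (hS : Convex ℝ S) (hcov : ∀ x, x ∈ S ↔ ∃ t, ∀ k, 0 ≤ bary (V t) k x)
    {A : Finset (ℤ × ℤ)} (hA : ∀ t j, V t j ∈ A) (hAS : ∀ p ∈ A, toPlane p ∈ S)
    (hs : IsFlatOn V A s) {u w : ℝ × ℝ} (huw : u ≠ w) (hside : ∀ x ∈ S, 0 ≤ det3 u w x) (n : ℕ) :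
    ∀ a ∈ A, ∀ b ∈ A, det3 u w (toPlane a) = 0 → det3 u w (toPlane b) = 0 →
      height (toPlane a) < height (toPlane b) →
      (A.filter fun x => height (toPlane x) < height (toPlane b)).card = n →
      s b = s a * colorStep a b := by
  induction n using Nat.strong_induction_on with
  | _ n ih =>
    rintro a ha b hb h0a h0b hab rfl
    have hcard : ∀ p ∈ A, height (toPlane p) < height (toPlane b) →
        (A.filter fun x => height (toPlane x) < height (toPlane p)).card <
          (A.filter fun x => height (toPlane x) < height (toPlane b)).card := by
      intro p hp hpb
      refine Finset.card_lt_card (Finset.ssubset_iff_of_subset ?_ |>.2 ⟨p, ?_, ?_⟩)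
      · intro x hx
        simp only [Finset.mem_filter] at hx ⊢
        exact ⟨hx.1, hx.2.trans hpb⟩
      · simp [hp, hpb]
      · simp
    obtain ⟨δ, hδ, hball⟩ := exists_ball_mem_triangle V (toPlane b)
    obtain ⟨ε, hε, hε1, hmem⟩ := exists_pos_smul_mem Metric.isOpen_ball
      (Metric.mem_ball_self hδ) (toPlane a - toPlane b)
    -- a triangle that contains the end of the side at `b`
    obtain ⟨x, hx⟩ : ∃ x, x = (1 - ε) • toPlane b + ε • toPlane a := ⟨_, rfl⟩
    have hx' : toPlane b + ε • (toPlane a - toPlane b) = x := by rw [hx]; module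
    rw [hx'] at hmem
    have hxb : height x < height (toPlane b) := by
      rw [hx, height_combination]
      nlinarith
    have hxS : x ∈ S := by
      rw [hx]
      exact hS (hAS b hb) (hAS a ha) (by linarith) hε.le (by ring)
    have h0x : det3 u w x = 0 := by
      rw [hx, det3_combination _ _ _ _ (by ring), h0a, h0b]
      ring
    obtain ⟨t, hxt⟩ := (hcov x).1 hxS
    have hbt := hball x hmem t hxt
    -- as the triangle is on one side of the line, it has an edge on the line
    obtain ⟨i, hi⟩ : ∃ i, bary (V t) i ((1 / 2 : ℝ) • toPlane b + (1 / 2 : ℝ) • x) = 0 := by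
      by_contra! hne
      have hin : (1 / 2 : ℝ) • toPlane b + (1 / 2 : ℝ) • x ∈ {x | ∀ i, 0 < bary (V t) i x} := by
        intro k
        refine lt_of_le_of_ne ?_ (hne k).symm
        rw [bary_combination _ _ _ (by norm_num)]
        have := hbt k
        have := hxt k
        positivity
      obtain ⟨η, hη, -, hmem⟩ := exists_pos_smul_mem isOpen_bary_pos hin (w.2 - u.2, -(w.1 - u.1))
      have h1 := hside _ ((hcov _).2 ⟨t, fun k => (hmem k).le⟩)
      have h2 : det3 u w ((1 / 2 : ℝ) • toPlane b + (1 / 2 : ℝ) • x) = 0 := by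
        rw [det3_combination _ _ _ _ (by norm_num), h0b, h0x]
        ring
      have h3 : ∀ z : ℝ × ℝ, det3 u w (z + η • (w.2 - u.2, -(w.1 - u.1))) =
          det3 u w z - η * ((w.1 - u.1) ^ 2 + (w.2 - u.2) ^ 2) := fun z => by
        simp only [det3, Prod.fst_add, Prod.snd_add, Prod.smul_fst, Prod.smul_snd, smul_eq_mul]
        ring
      have h4 : 0 < (w.1 - u.1) ^ 2 + (w.2 - u.2) ^ 2 := by
        by_contra h5
        refine huw (Prod.ext ?_ ?_) <;> nlinarith [sq_nonneg (w.1 - u.1), sq_nonneg (w.2 - u.2)]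
      rw [h3, h2] at h1
      have := mul_pos hη h4
      linarith
    obtain ⟨e1, e2⟩ := onEdge_of_midpoint hbt hxt hi
    obtain ⟨j, hij, hj⟩ := exists_liesAbove_of_onEdge (hpos t) e1 e2 hxb
    have hp : det3 u w (toPlane (V t j)) = 0 := by
      have h1 := eq_of_mem_line (fun h => vertex_ne_vertex (hpos t) i (toPlane_injective h)) e1.2
        e2.2 (onEdge_vertex (hpos t) hij).2 hxb.ne
      have h2 : ∀ c : ℝ, toPlane b + c • (x - toPlane b) = (1 - c) • toPlane b + c • x :=
        fun c => by module
      rw [h1, h2, det3_combination _ _ _ _ (by ring), h0b, h0x]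
      ring
    have hpA := hA t j
    have h1 : s (V t j) = s a * colorStep a (V t j) := by
      rcases lt_trichotomy (height (toPlane a)) (height (toPlane (V t j))) with hlt | heq | hgt
      · exact ih _ (hcard _ hpA hj.2) a ha _ hpA h0a hp hlt rfl
      · rw [← eq_of_height_eq heq]; simp
      · rw [ih _ (hcard _ ha hab) _ hpA a ha hp h0a hgt rfl, mul_assoc]
        simp
    rw [hs t j b hb hpA hj, h1, mul_assoc, colorStep_mul_colorStep_of_det3]
    exact det3_eq_zero_of_mem_line huw h0a hp h0b

end Sweep

/-! ### The boundary walk of a dissected polygon -/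

lemma walk_map_eq_of_isChain {s : ℤ × ℤ → FreeGroup (Color × Color)} (l : List (ℤ × ℤ)) :
    ∀ {p : ℤ × ℤ}, List.IsChain (fun p q => s q = s p * colorStep p q) (p :: l) →
      walk ((p :: l).map parityColor) = (s p)⁻¹ * s ((p :: l).getLast (by simp)) := by
  induction l with
  | nil => intro p _; simp
  | cons q l ih =>
    intro p h
    rw [List.isChain_cons_cons] at h
    have h1 := ih h.2
    rw [List.map_cons] at h1
    rw [List.map_cons, List.map_cons, walk_cons_cons, h1, List.getLast_cons (List.cons_ne_nil q l),
      h.1]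
    simp [colorStep, ← mul_assoc]

/-- The polygon lies to the left of each of its sides. -/
lemma IsCCW.side {x : ℤ × ℤ} {l : List (ℤ × ℤ)} (hc : IsCCW (x :: l)) (hl : 2 ≤ l.length)
    {A B : List (ℤ × ℤ)} {p q : ℤ × ℤ} (h : x :: (l ++ [x]) = A ++ p :: q :: B) :
    p ≠ q ∧ p ∈ x :: l ∧ q ∈ x :: l ∧ ∀ y ∈ x :: l, 0 ≤ orientDet p q y := by
  have key : (p ∈ x :: l ∧ q ∈ x :: l) ∧
      ∀ y ∈ x :: l, y = p ∨ y = q ∨ 0 < orientDet p q y := by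
    rcases List.eq_nil_or_concat' B with rfl | ⟨B, z, rfl⟩
    · have h1 : (x :: l) ++ [x] = (A ++ [p]) ++ [q] := by simpa using h
      obtain ⟨h2, h3⟩ := List.append_inj' h1 rfl
      obtain rfl : x = q := by simpa using h3
      cases A with
      | nil =>
        simp at h2
        simp [h2.2] at hl
      | cons a A =>
        simp only [List.cons_append, List.cons.injEq] at h2
        obtain ⟨rfl, rfl⟩ := h2
        refine ⟨by simp, fun y hy => ?_⟩
        rcases List.mem_cons.1 hy with rfl | hy
        · simp
        rcases List.mem_append.1 hy with hy | hy
        · right; right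
          rw [← orientDet_rotate]
          exact hc x y p
            (((List.singleton_sublist.2 hy).append (List.Sublist.refl [p])).cons_cons x)
        · left; simpa using hy
    · have h1 : (x :: l) ++ [x] = (A ++ p :: q :: B) ++ [z] := by simpa using h
      obtain ⟨h2, -⟩ := List.append_inj' h1 rfl
      rw [h2] at hc ⊢
      refine ⟨by simp, fun y hy => ?_⟩
      rcases List.mem_append.1 hy with hy | hy
      · right; right
        rw [orientDet_rotate]
        have h3 : [p, q].Sublist (p :: q :: B) := by simp
        exact hc y p q ((List.singleton_sublist.2 hy).append h3)
      rcases List.mem_cons.1 hy with rfl | hy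
      · simp
      rcases List.mem_cons.1 hy with rfl | hy
      · simp
      · right; right
        refine hc p q y (List.Sublist.trans ?_ (List.sublist_append_right A _))
        exact ((List.singleton_sublist.2 hy).cons_cons q).cons_cons p
  have h0 : ∀ a b, orientDet a b a = 0 ∧ orientDet a b b = 0 ∧ orientDet a a b = 0 := fun a b => by
    simp only [orientDet_eq]
    refine ⟨?_, ?_, ?_⟩ <;> ring
  refine ⟨?_, key.1.1, key.1.2, fun y hy => ?_⟩
  · rintro rfl
    have hall : ∀ y ∈ x :: l, y = p := fun y hy => by
      rcases key.2 y hy with h1 | h1 | h1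
      · exact h1
      · exact h1
      · rw [(h0 p y).2.2] at h1
        exact absurd h1 (lt_irrefl _)
    match l, hl with
    | y :: z :: l, _ =>
      have h1 := hc x y z (by simp)
      rw [hall x (by simp), hall y (by simp), hall z (by simp), (h0 p p).1] at h1
      exact lt_irrefl _ h1
  · rcases key.2 y hy with rfl | rfl | h1
    · exact (h0 _ _).1.ge
    · exact (h0 _ _).2.1.ge
    · exact h1.le

namespace ConvexLatticePolygon

variable {P : ConvexLatticePolygon}

/-- The flat labelling of the vertices of a dissection shows that the boundary walk is trivial. -/
theorem contractible_of_hasIntegralDissection (h : P.HasIntegralDissection) :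
    Contractible P.boundaryWord := by
  obtain ⟨m, T, hT, hk⟩ := h
  choose V hpos hreg hdet using fun t => (T t).exists_counterclockwise
  have heven : ∀ t, Even (orientDet (V t 0) (V t 1) (V t 2)) := fun t => by
    rw [hdet, even_abs, ← LatticeTriangle.isInt_area_iff]
    exact hk t
  have hdisj : ∀ t t', t ≠ t' → Disjoint (interior (tri (V t 0) (V t 1) (V t 2)))
      (interior (tri (V t' 0) (V t' 1) (V t' 2))) := fun t t' htt => by
    rw [← hreg, ← hreg]
    exact hT.disjoint_interior t t' htt
  have hS : Convex ℝ P.region := convex_convexHull _ _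
  have hcov : ∀ x, x ∈ P.region ↔ ∃ t, ∀ k, 0 ≤ bary (V t) k x := fun x => by
    simp only [← hT.union_eq, Set.mem_iUnion, hreg, mem_tri_iff_bary (hpos _)]
  classical
  set A : Finset (ℤ × ℤ) :=
    (Finset.univ.image fun a : Fin m × Fin 3 => V a.1 a.2) ∪ P.vertexList.toFinset with hAdef
  have hA : ∀ t j, V t j ∈ A := fun t j =>
    Finset.mem_union_left _ (Finset.mem_image.2 ⟨(t, j), Finset.mem_univ _, rfl⟩)
  have hLA : ∀ p ∈ P.vertexList, p ∈ A := fun p hp =>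
    Finset.mem_union_right _ (List.mem_toFinset.2 hp)
  have hAS : ∀ p ∈ A, toPlane p ∈ P.region := by
    intro p hp
    rcases Finset.mem_union.1 hp with hp | hp
    · obtain ⟨⟨t, j⟩, -, rfl⟩ := Finset.mem_image.1 hp
      obtain ⟨i, hij⟩ := exists_ne j
      exact (hcov _).2 ⟨t, (onEdge_vertex (hpos t) hij).1⟩
    · rw [P.region_eq_hullOf]
      exact toPlane_mem_hullOf (List.mem_toFinset.1 hp)
  obtain ⟨s, hs⟩ := exists_isFlatOn hpos heven hdisj hS hcov hA
  rw [boundaryWord, contractible_coe_iff (by simpa using P.vertexList_ne_nil)]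
  have hc := P.isCCW_vertexList
  have hlen : 3 ≤ P.vertexList.length := by rw [P.length_vertexList]; exact P.three_le
  have hreg' := P.region_eq_hullOf
  match hL : P.vertexList, P.vertexList_ne_nil with
  | x :: l, _ =>
    rw [hL] at hc hlen hreg' hLA
    have hchain : List.IsChain (fun p q => s q = s p * colorStep p q) (x :: (l ++ [x])) := by
      rw [List.isChain_iff_forall_rel_of_append_cons_cons]
      intro p q A' B' hAB
      obtain ⟨hne, hp, hq, hside⟩ := hc.side (by simpa using hlen) hAB
      have hside' : ∀ y ∈ P.region, 0 ≤ det3 (toPlane p) (toPlane q) y := by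
        intro y hy
        rw [hreg'] at hy
        refine hullOf_subset (convex_det3_nonneg (toPlane p) (toPlane q)) (fun a ha => ?_) hy
        change 0 ≤ det3 _ _ _
        rw [← cast_orientDet]
        exact_mod_cast hside a ha
      have hside'' := fun n => hs.eq_of_side hpos hS hcov hA hAS
        (fun h => hne (toPlane_injective h)) hside' n
      rcases lt_trichotomy (height (toPlane p)) (height (toPlane q)) with hlt | heq | hgt
      · exact hside'' _ p (hLA p hp) q (hLA q hq) (by simp) (by simp) hlt rfl
      · exact absurd (eq_of_height_eq heq) hne
      · rw [hside'' _ q (hLA q hq) p (hLA p hp) (by simp) (by simp) hgt rfl, mul_assoc]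
        simp
    have h1 := walk_map_eq_of_isChain _ hchain
    simp only [IsClosedTrivial, List.map_cons]
    simpa using h1

theorem tfae_dissections (P : ConvexLatticePolygon) :
    List.TFAE [P.HasUnitAreaDissection, P.HasIntegralDissection,
      P.HasIntegralDiagonalDissection, Contractible P.boundaryWord] := by
  tfae_have 1 → 2 := fun ⟨m, T, hT, hk⟩ => ⟨m, T, hT, fun i => ⟨1, by rw [hk i]; simp⟩⟩
  tfae_have 2 → 1 := hasUnitAreaDissection_of_integral
  tfae_have 2 → 4 := contractible_of_hasIntegralDissection
  tfae_have 4 → 3 := hasIntegralDiagonalDissection_of_contractible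
  tfae_have 3 → 2 := fun ⟨m, T, hT, _, hk⟩ => ⟨m, T, hT, hk⟩
  tfae_finish

end ConvexLatticePolygon

lemma RAM.decidesInLinearTime_contractible :
    RAM.DecidesInLinearTime RAM.contractProgram (fun P => Contractible P.boundaryWord) := by
  refine ⟨24, fun P => RAM.run_contractProgram P.vertexList_ne_nil ?_⟩
  have := P.three_le
  rw [P.length_vertexList]
  omega

theorem theorem2p1 :
    (∀ P : ConvexLatticePolygon,
      List.TFAE [P.HasUnitAreaDissection, P.HasIntegralDissection,
        P.HasIntegralDiagonalDissection, Contractible P.boundaryWord]) ∧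
    ∃ prog : RAM.Program,
      RAM.DecidesInLinearTime prog (fun P => P.HasUnitAreaDissection) ∧
      RAM.DecidesInLinearTime prog (fun P => P.HasIntegralDissection) ∧
      RAM.DecidesInLinearTime prog (fun P => P.HasIntegralDiagonalDissection) ∧
      RAM.DecidesInLinearTime prog (fun P => Contractible P.boundaryWord) := by
  refine ⟨fun P => P.tfae_dissections, RAM.contractProgram, ?_⟩
  have h4 := RAM.decidesInLinearTime_contractible
  have h1 : (fun P : ConvexLatticePolygon => P.HasUnitAreaDissection) =
      fun P => Contractible P.boundaryWord := funext fun P => propext (P.tfae_dissections.out 0 3)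
  have h2 : (fun P : ConvexLatticePolygon => P.HasIntegralDissection) =
      fun P => Contractible P.boundaryWord := funext fun P => propext (P.tfae_dissections.out 1 3)
  have h3 : (fun P : ConvexLatticePolygon => P.HasIntegralDiagonalDissection) =
      fun P => Contractible P.boundaryWord := funext fun P => propext (P.tfae_dissections.out 2 3)
  rw [h1, h2, h3]
  exact ⟨h4, h4, h4, h4⟩
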